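/- **Certifiable lower bounds of non-Gaussian entanglement.** Let $m\ge 0$ and $N\ge 1$, and consider $M=2m$ bosonic modes, split into $m$ modes $A$ and $m$ modes $B$, with Hilbert space $\mathcal H=L^2(\mathbb R^m)\otimes L^2(\mathbb R^m)$. A state is a positive operator of unit trace on $\mathcal H$. For $\vec\xi\in\mathbb C^m$ let $D(\vec\xi)=\exp\big(\sum_k \xi_k a_k^\dagger-\xi_k^* a_k\big)$ be the displacement operator of $m$ modes, and put $D_A(\vec\xi)=D(\vec\xi)\otimes\mathbb 1$, $D_B(\vec\xi)=\mathbb 1\otimes D(\vec\xi)$. Let $T_B$ be the partial transposition on $B$ in the Fock (equivalently, position) basis and $\|T\|_1=\operatorname{tr}|T|\in[0,\infty]$ the trace norm. Let SEP be the set of separable states (trace-norm limits of finite convex combinations of product states $\rho_A\otimes\rho_B$) and PPT the set of states $\sigma$ with $\sigma^{T_B}\succeq 0$. Let $(\vec\xi_k^A,\vec\xi_k^B)\in\mathbb C^m\times\mathbb C^m$, $k=1,\dots,N$, and let $\Lambda\in\mathbb C^{2m\times 2m}$ satisfy $\Lambda^\dagger\begin{pmatrix}\mathbb 1&0\\0&-\mathbb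 1\end{pmatrix}\Lambda=\begin{pmatrix}\mathbb 1&0\\0&-\mathbb 1\end{pmatrix}$ and $$\begin{pmatrix}\vec\xi_k^A\\ \vec\xi_k^{A*}\end{pmatrix}=\Lambda\begin{pmatrix}\vec\xi_k^B\\ \vec\xi_k^{B*}\end{pmatrix}\qquad\text{for all }k .$$ For a state $\rho$ let $\mathbf C_2(\rho,\Xi)$ be the $N\times N$ matrix with entries $$[\mathbf C_2(\rho,\Xi)]_{j,k}=\frac1N\operatorname{tr}\big[\rho\, D_A(\vec\xi_j^A-\vec\xi_k^A)\,D_B(\vec\xi_j^B-\vec\xi_k^B)\big].$$ This matrix is Hermitian. Let $\lambda_-$ be its smallest eigenvalue and $\mathcal E_C(\rho,\Xi)=\max(0,-\lambda_-)$. Every state has a bounded partial transpose, and $$\mathcal E_C(\rho,\Xi)\le\inf_{\sigma\in\mathrm{SEP}}\|\sigma-\rho\|_1,\qquad \mathcal E_C(\rho,\Xi)\le\inf_{\sigma\in\mathrm{PPT}}\|\sigma^{T_B}-\rho^{T_B}\|_1 .$$ Moreover, with the Wigner function $W_\rho(\vec\alpha)=(2/\pi)^{2m}\operatorname{tr}[\rho\,\mathbf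 D(\vec\alpha)\,\Pi\,\mathbf D(\vec\alpha)^\dagger]$, where $\vec\alpha=(\vec\alpha_A,\vec\alpha_B)\in\mathbb C^{2m}$, $\mathbf D(\vec\alpha)=D_A(\vec\alpha_A)D_B(\vec\alpha_B)$ and $\Pi$ is the parity operator of all $2m$ modes, $\mathcal E_C$ bounds the Wigner negativity volume: $$\mathcal E_C(\rho,\Xi)\le\frac12\int_{\mathbb C^{2m}}\big(|W_\rho(\vec\alpha)|-W_\rho(\vec\alpha)\big)\,d\vec\alpha\in[0,\infty].$$ In particular, if $\mathcal E_C(\rho,\Xi)>0$, then $\rho$ is neither separable nor PPT, and $W_\rho$ takes a negative value. -/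

import Mathlib

open MeasureTheory
open scoped TensorProduct ENNReal Matrix

noncomputable section

namespace ECDWitness

/-! ### Trace, trace norm and states on a Hilbert space -/

section Trace

variable {H : Type*} [NormedAddCommGroup H] [InnerProductSpace ℂ H] [CompleteSpace H]

variable (H) in
/-- The index set of an orthonormal (Hilbert) basis of `H`. -/
def basisIndex : Set H := (exists_hilbertBasis ℂ H).choose

variable (H) in
/-- An orthonormal (Hilbert) basis of `H`; the traces below do not depend on this choice. -/
def basis : HilbertBasis (basisIndex H) ℂ H := (exists_hilbertBasis ℂ H).choose_spec.choose

/-- The trace `∑ᵢ ⟨eᵢ, T eᵢ⟩` of a trace class operator. -/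
def opTrace (T : H →L[ℂ] H) : ℂ := ∑' i, inner ℂ (basis H i) (T (basis H i))

/-- The trace, in `[0, ∞]`, of a positive operator. -/
def positiveTrace (T : H →L[ℂ] H) : ℝ≥0∞ :=
  ∑' i, ENNReal.ofReal (inner ℂ (basis H i) (T (basis H i))).re

/-- The trace norm `‖T‖₁ = tr |T|`, with `|T| = √(T† T)`; it is `∞` if `T` is not trace class. -/
def traceNorm (T : H →L[ℂ] H) : ℝ≥0∞ := positiveTrace (CFC.abs T)

/-- States (density operators): positive operators of unit trace. -/
def IsState (ρ : H →L[ℂ] H) : Prop := ρ.IsPositive ∧ positiveTrace ρ = 1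

end Trace

/-! ### Bosonic modes in the position representation -/

/-- The Hilbert space `L²(ℝᵐ)` of `m` modes. -/
abbrev ModeSpace (m : ℕ) : Type := Lp ℂ 2 (volume : Measure (Fin m → ℝ))

/-- The wave function of the displaced state,
`x ↦ exp(i ∑ₖ (√2 Im ξₖ xₖ - Re ξₖ Im ξₖ)) f(x - √2 Re ξ)`. -/
def displaceFun {m : ℕ} (ξ : Fin m → ℂ) (f : (Fin m → ℝ) → ℂ) (x : Fin m → ℝ) : ℂ :=
  Complex.exp (Complex.I *
      ((∑ k, (√2 * (ξ k).im * x k - (ξ k).re * (ξ k).im) : ℝ) : ℂ)) *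
    f (fun k => x k - √2 * (ξ k).re)

theorem measurePreserving_shift {m : ℕ} (ξ : Fin m → ℂ) :
    MeasurePreserving (fun (x : Fin m → ℝ) (k : Fin m) => x k - √2 * (ξ k).re) volume volume :=
  measurePreserving_sub_right volume (fun k => √2 * (ξ k).re)

theorem norm_displaceFun {m : ℕ} (ξ : Fin m → ℂ) (f : (Fin m → ℝ) → ℂ) (x : Fin m → ℝ) :
    ‖displaceFun ξ f x‖ = ‖f (fun k => x k - √2 * (ξ k).re)‖ := by
  rw [displaceFun, norm_mul, mul_comm Complex.I, Complex.norm_exp_ofReal_mul_I, one_mul]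

theorem aestronglyMeasurable_displaceFun {m : ℕ} (ξ : Fin m → ℂ) (f : ModeSpace m) :
    AEStronglyMeasurable (displaceFun ξ f) volume := by
  refine AEStronglyMeasurable.mul (Continuous.aestronglyMeasurable (by fun_prop)) ?_
  exact (Lp.aestronglyMeasurable f).comp_measurePreserving (measurePreserving_shift ξ)

theorem eLpNorm_displaceFun {m : ℕ} (ξ : Fin m → ℂ) (f : ModeSpace m) :
    eLpNorm (displaceFun ξ f) 2 volume = eLpNorm f 2 volume := by
  rw [← eLpNorm_comp_measurePreserving (Lp.aestronglyMeasurable f) (measurePreserving_shift ξ)]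
  exact eLpNorm_congr_norm_ae (Filter.Eventually.of_forall fun x => norm_displaceFun ξ f x)

theorem memLp_displaceFun {m : ℕ} (ξ : Fin m → ℂ) (f : ModeSpace m) :
    MemLp (displaceFun ξ f) 2 volume :=
  ⟨aestronglyMeasurable_displaceFun ξ f, by
    rw [eLpNorm_displaceFun]; exact Lp.eLpNorm_lt_top f⟩

/-- The displacement operator `D(ξ) = exp(∑ₖ ξₖ aₖ† - ξₖ* aₖ)`, where `aₖ = (xₖ + ∂ₖ)/√2`: since
`∑ₖ ξₖ aₖ† - ξₖ* aₖ = √2 ∑ₖ (i Im ξₖ xₖ - Re ξₖ ∂ₖ)`, the unitary group `t ↦ D(tξ)` that it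
generates acts on wave functions as `displaceFun (tξ)`. -/
def displacement {m : ℕ} (ξ : Fin m → ℂ) : ModeSpace m →L[ℂ] ModeSpace m :=
  LinearIsometry.toContinuousLinearMap
    { toFun := fun f => (memLp_displaceFun ξ f).toLp (displaceFun ξ f)
      map_add' := fun f g => by
        rw [← MemLp.toLp_add, MemLp.toLp_eq_toLp_iff]
        have h := (measurePreserving_shift ξ).quasiMeasurePreserving.ae (Lp.coeFn_add f g)
        filter_upwards [h] with x hx
        simp only [displaceFun, Pi.add_apply] at hx ⊢
        rw [hx, mul_add]
      map_smul' := fun c f => by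
        rw [RingHom.id_apply, ← MemLp.toLp_const_smul, MemLp.toLp_eq_toLp_iff]
        have h := (measurePreserving_shift ξ).quasiMeasurePreserving.ae (Lp.coeFn_smul c f)
        filter_upwards [h] with x hx
        simp only [displaceFun, Pi.smul_apply, smul_eq_mul] at hx ⊢
        rw [hx, mul_left_comm]
      norm_map' := fun f => by
        change ‖(memLp_displaceFun ξ f).toLp (displaceFun ξ f)‖ = ‖f‖
        rw [Lp.norm_toLp, eLpNorm_displaceFun, Lp.norm_def] }

/-- The parity operator `(Π f)(x) = f(-x)`. -/
def parity (m : ℕ) : ModeSpace m →L[ℂ] ModeSpace m :=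
  (Lp.compMeasurePreservingₗᵢ ℂ (fun x : Fin m → ℝ => -x)
    (Measure.measurePreserving_neg volume)).toContinuousLinearMap

/-- The displaced parity operator `D(α) Π D(α)†`. -/
def displacedParity {m : ℕ} (α : Fin m → ℂ) : ModeSpace m →L[ℂ] ModeSpace m :=
  displacement α * parity m * (displacement α).adjoint

/-! ### Two parties `A` and `B` with `m` modes each -/

/-- The Hilbert space tensor product of the mode spaces of `A` and `B`. -/
abbrev Bipartite (m : ℕ) : Type :=
  UniformSpace.Completion (ModeSpace m ⊗[ℂ] ModeSpace m)

/-- The product vector `f ⊗ g`. -/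
def productVector {m : ℕ} (f g : ModeSpace m) : Bipartite m := ((f ⊗ₜ[ℂ] g : _ ⊗[ℂ] _) :)

/-- The operator `S ⊗ T`. -/
def tensorOp {m : ℕ} (S T : ModeSpace m →L[ℂ] ModeSpace m) : Bipartite m →L[ℂ] Bipartite m :=
  (TensorProduct.mapL S T).completion

/-- The displacement operator of the modes of `A`. -/
def displacementA {m : ℕ} (ξ : Fin m → ℂ) : Bipartite m →L[ℂ] Bipartite m :=
  tensorOp (displacement ξ) 1

/-- The displacement operator of the modes of `B`. -/
def displacementB {m : ℕ} (ξ : Fin m → ℂ) : Bipartite m →L[ℂ] Bipartite m :=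
  tensorOp 1 (displacement ξ)

/-- `S = T^{T_B}`: for real wave functions `g`, `g'` this reads
`⟨f ⊗ g, S (f' ⊗ g')⟩ = ⟨f ⊗ g', T (f' ⊗ g)⟩`. Here `star g` is the complex conjugate of the wave
function `g`, so that the transposition is the one of the position basis, which is also the one of
the Fock basis since the Fock states have real wave functions. -/
def IsPartialTranspose {m : ℕ} (T S : Bipartite m →L[ℂ] Bipartite m) : Prop :=
  ∀ f f' g g' : ModeSpace m,
    inner ℂ (productVector f g) (S (productVector f' g')) =
      inner ℂ (productVector f (star g')) (T (productVector f' (star g)))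

open Classical in
/-- The partial transpose `T^{T_B}` (the default `0` is for bounded operators `T` that have no
bounded partial transpose; trace class operators have one). -/
def partialTranspose {m : ℕ} (T : Bipartite m →L[ℂ] Bipartite m) :
    Bipartite m →L[ℂ] Bipartite m :=
  if h : ∃ S, IsPartialTranspose T S then h.choose else 0

/-- The states `ρ_A ⊗ ρ_B`. -/
def productStates (m : ℕ) : Set (Bipartite m →L[ℂ] Bipartite m) :=
  {τ | ∃ ρA ρB : ModeSpace m →L[ℂ] ModeSpace m, IsState ρA ∧ IsState ρB ∧ τ = tensorOp ρA ρB}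

/-- The set SEP of separable states: limits in trace norm of finite mixtures of product states. -/
def SEP (m : ℕ) : Set (Bipartite m →L[ℂ] Bipartite m) :=
  {σ | IsState σ ∧ ∀ ε : ℝ≥0∞, 0 < ε →
    ∃ τ ∈ convexHull ℝ (productStates m), traceNorm (σ - τ) < ε}

/-- The set PPT of states with positive partial transpose. -/
def PPT (m : ℕ) : Set (Bipartite m →L[ℂ] Bipartite m) :=
  {σ | IsState σ ∧ (partialTranspose σ).IsPositive}

/-- The trace distance to the separable states. -/
def entanglementSEP {m : ℕ} (ρ : Bipartite m →L[ℂ] Bipartite m) : ℝ≥0∞ :=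
  ⨅ σ ∈ SEP m, traceNorm (σ - ρ)

/-- The trace distance between the partial transposes of `ρ` and of the PPT states. -/
def entanglementPPT {m : ℕ} (ρ : Bipartite m →L[ℂ] Bipartite m) : ℝ≥0∞ :=
  ⨅ σ ∈ PPT m, traceNorm (partialTranspose σ - partialTranspose ρ)

/-- The Wigner function `W_ρ(α) = (2/π)^{2m} tr[ρ D(α) Π D(α)†]` of the `2m` modes, where
`α = (α_A, α_B)` and `D(α)`, `Π` are the displacement and the parity of all modes; the trace is
real. -/
def wigner {m : ℕ} (ρ : Bipartite m →L[ℂ] Bipartite m) (α : (Fin m → ℂ) × (Fin m → ℂ)) : ℝ :=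
  (2 / Real.pi) ^ (2 * m) *
    (opTrace (ρ * tensorOp (displacedParity α.1) (displacedParity α.2))).re

/-- The Wigner negativity volume `½ ∫ (|W_ρ| - W_ρ)`, in `[0, ∞]`. -/
def negativityVolume {m : ℕ} (ρ : Bipartite m →L[ℂ] Bipartite m) : ℝ≥0∞ :=
  ∫⁻ α, ENNReal.ofReal ((|wigner ρ α| - wigner ρ α) / 2)

/-! ### The witness -/

/-- The matrix `diag(1, -1)`. -/
def signMatrix (m : ℕ) : Matrix (Fin m ⊕ Fin m) (Fin m ⊕ Fin m) ℂ :=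
  Matrix.fromBlocks 1 0 0 (-1)

/-- The column `(ξ, ξ*)`. -/
def doubled {m : ℕ} (ξ : Fin m → ℂ) : Fin m ⊕ Fin m → ℂ := Sum.elim ξ (star ξ)

/-- The matrix `C₂(ρ, Ξ)`. -/
def C₂ {m N : ℕ} (ρ : Bipartite m →L[ℂ] Bipartite m) (ξA ξB : Fin N → Fin m → ℂ) :
    Matrix (Fin N) (Fin N) ℂ :=
  Matrix.of fun j k => (1 / (N : ℂ)) *
    opTrace (ρ * displacementA (ξA j - ξA k) * displacementB (ξB j - ξB k))

/-- The real eigenvalues of a complex square matrix. -/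
def realEigenvalues {N : ℕ} (C : Matrix (Fin N) (Fin N) ℂ) : Set ℝ :=
  {μ | Module.End.HasEigenvalue (Matrix.toLin' C) (μ : ℂ)}

/-- The smallest eigenvalue of a Hermitian matrix. -/
def minEigenvalue {N : ℕ} (C : Matrix (Fin N) (Fin N) ℂ) : ℝ := sInf (realEigenvalues C)

/-- The quantity `max(0, -λ₋)`. -/
def witness {m N : ℕ} (ρ : Bipartite m →L[ℂ] Bipartite m) (ξA ξB : Fin N → Fin m → ℂ) : ℝ :=
  max 0 (-minEigenvalue (C₂ ρ ξA ξB))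

end ECDWitness

end

/-!
A matrix preserving `diag(1, -1)` preserves the symplectic product `ω` of doubled vectors, so that
`ω(ξᴬⱼ, ξᴬₖ) = ω(ξᴮⱼ, ξᴮₖ)`. Transposition on `B` reverses the sign of the Weyl phase of the second
party, so the phases of the two parties cancel, and `N v† C₂ v` is the sum of
`⟨F u, ρ^(T_B) F u⟩` over an orthonormal basis of product vectors `u`, with
`F = ∑ⱼ vⱼ* D(ξᴬⱼ) ⊗ D(ξᴮⱼ)ᵀ`. As `‖F‖² ≤ N` for a unit vector `v`, the negative part of `v† C₂ v`
is at most `‖σ^(T_B) - ρ^(T_B)‖₁` for every `σ` with `σ^(T_B) ≥ 0`.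

The same identity shows that `v† C₂ v` is nonnegative on convex combinations of product states.
Being the expectation of an operator of norm at most one, it is `1`-Lipschitz in the trace norm,
which passes the nonnegativity to limits and gives the bound by the distance to the separable
states.

For the Wigner function, `v† C₂ v` is the limit, as a Gaussian regularisation is removed, of the
integral of `W_ρ` against the filter `|∑ⱼ vⱼ* exp(2i ω(ξⱼ, α))|² / N`, which takes values in
`[0, 1]`; so its negative part is at most the negativity volume.
-/

noncomputable section

namespace ECDWitness

/-! ### Traces of positive operators -/

section Parseval

variable {𝕜 : Type*} [RCLike 𝕜]
variable {H : Type*} [NormedAddCommGroup H] [InnerProductSpace 𝕜 H]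
variable {K : Type*} [NormedAddCommGroup K] [InnerProductSpace 𝕜 K]
variable {ι κ : Type*}

theorem hasSum_sq_norm_inner (b : HilbertBasis ι 𝕜 H) (x : H) :
    HasSum (fun i => ‖inner 𝕜 (b i) x‖ ^ 2) (‖x‖ ^ 2) := by
  have h := (b.hasSum_inner_mul_inner x x).mapL RCLike.reCLM
  rw [RCLike.reCLM_apply, ← norm_sq_eq_re_inner] at h
  refine h.congr_fun fun i => ?_
  rw [inner_mul_symm_re_eq_norm, norm_mul, norm_inner_symm, sq]

theorem tsum_sq_enorm_inner (b : HilbertBasis ι 𝕜 H) (x : H) :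
    ∑' i, ‖inner 𝕜 (b i) x‖ₑ ^ 2 = ‖x‖ₑ ^ 2 := by
  have h := hasSum_sq_norm_inner b x
  simpa only [h.tsum_eq, ENNReal.ofReal_pow (norm_nonneg _), ofReal_norm, eq_comm] using
    ENNReal.ofReal_tsum_of_nonneg (fun i => sq_nonneg ‖inner 𝕜 (b i) x‖) h.summable

theorem tsum_sq_enorm_inner_le {u : ι → H} (hu : Orthonormal 𝕜 u) (x : H) :
    ∑' i, ‖inner 𝕜 (u i) x‖ₑ ^ 2 ≤ ‖x‖ₑ ^ 2 := by
  have h := ENNReal.ofReal_le_ofReal (hu.tsum_inner_products_le x)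
  rw [ENNReal.ofReal_tsum_of_nonneg (fun i => sq_nonneg ‖inner 𝕜 (u i) x‖)
    (hu.inner_products_summable x)] at h
  simpa only [ENNReal.ofReal_pow (norm_nonneg _), ofReal_norm] using h

variable [CompleteSpace H] [CompleteSpace K]

theorem tsum_sq_enorm_apply_le_adjoint {u : ι → K} (hu : Orthonormal 𝕜 u)
    (c : HilbertBasis κ 𝕜 H) (A : K →L[𝕜] H) :
    ∑' i, ‖A (u i)‖ₑ ^ 2 ≤ ∑' j, ‖A.adjoint (c j)‖ₑ ^ 2 := by
  calc ∑' i, ‖A (u i)‖ₑ ^ 2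
      = ∑' i, ∑' j, ‖inner 𝕜 (c j) (A (u i))‖ₑ ^ 2 := by simp_rw [tsum_sq_enorm_inner]
    _ = ∑' j, ∑' i, ‖inner 𝕜 (c j) (A (u i))‖ₑ ^ 2 := ENNReal.tsum_comm
    _ = ∑' j, ∑' i, ‖inner 𝕜 (u i) (A.adjoint (c j))‖ₑ ^ 2 := by
        simp_rw [A.adjoint_inner_right, ← ofReal_norm, norm_inner_symm]
    _ ≤ ∑' j, ‖A.adjoint (c j)‖ₑ ^ 2 :=
        ENNReal.tsum_le_tsum fun j => tsum_sq_enorm_inner_le hu _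

theorem tsum_sq_enorm_apply_eq_adjoint (b : HilbertBasis ι 𝕜 K) (c : HilbertBasis κ 𝕜 H)
    (A : K →L[𝕜] H) : ∑' i, ‖A (b i)‖ₑ ^ 2 = ∑' j, ‖A.adjoint (c j)‖ₑ ^ 2 :=
  le_antisymm (tsum_sq_enorm_apply_le_adjoint b.orthonormal c A) <| by
    simpa only [ContinuousLinearMap.adjoint_adjoint] using
      tsum_sq_enorm_apply_le_adjoint c.orthonormal b A.adjoint

end Parseval

theorem ofReal_re_inner_self {E : Type*} [SeminormedAddCommGroup E] [InnerProductSpace ℂ E]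
    (x : E) : ENNReal.ofReal (inner ℂ x x).re = ‖x‖ₑ ^ 2 := by
  rw [← ofReal_norm, ← ENNReal.ofReal_pow (norm_nonneg _), norm_sq_eq_re_inner (𝕜 := ℂ) x]
  rfl

theorem isPositive_smul {E : Type*} [NormedAddCommGroup E] [InnerProductSpace ℂ E]
    {P : E →L[ℂ] E} (hP : P.IsPositive) {a : ℝ} (ha : 0 ≤ a) : (a • P).IsPositive := by
  simpa only [Complex.coe_smul] using hP.smul_of_nonneg (c := (a : ℂ)) (by exact_mod_cast ha)

section Trace

variable {H : Type*} [NormedAddCommGroup H] [InnerProductSpace ℂ H] [CompleteSpace H]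
variable {K : Type*} [NormedAddCommGroup K] [InnerProductSpace ℂ K] [CompleteSpace K]
variable {ι κ : Type*}

/-- The positive square root of a positive operator. -/
def sqrtOp (P : H →L[ℂ] H) : H →L[ℂ] H := CFC.sqrt P

theorem adjoint_sqrtOp (P : H →L[ℂ] H) : (sqrtOp P).adjoint = sqrtOp P :=
  (IsSelfAdjoint.of_nonneg (CFC.sqrt_nonneg P)).adjoint_eq

theorem sqrtOp_mul_self {P : H →L[ℂ] H} (hP : P.IsPositive) : sqrtOp P * sqrtOp P = P :=
  CFC.sqrt_mul_sqrt_self P (P.nonneg_iff_isPositive.2 hP)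

theorem inner_sqrtOp_sqrtOp {P : H →L[ℂ] H} (hP : P.IsPositive) (x y : H) :
    inner ℂ (sqrtOp P x) (sqrtOp P y) = inner ℂ x (P y) := by
  rw [← ContinuousLinearMap.adjoint_inner_right, adjoint_sqrtOp, ← mul_apply_eq_comp,
    sqrtOp_mul_self hP]

/-- The vectors `√P eᵢ` that decompose a positive operator as `P = ∑ᵢ |√P eᵢ⟩⟨√P eᵢ|`. -/
def sqrtVec (P : H →L[ℂ] H) (i : basisIndex H) : H := sqrtOp P (basis H i)

theorem hasSum_inner_sqrtVec {P : H →L[ℂ] H} (hP : P.IsPositive) (x y : H) :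
    HasSum (fun i => inner ℂ x (sqrtVec P i) * inner ℂ (sqrtVec P i) y) (inner ℂ x (P y)) := by
  have h := (basis H).hasSum_inner_mul_inner (sqrtOp P x) (sqrtOp P y)
  simp_rw [inner_sqrtOp_sqrtOp hP, ← ContinuousLinearMap.adjoint_inner_right (sqrtOp P) x,
    ← ContinuousLinearMap.adjoint_inner_left (sqrtOp P) y, adjoint_sqrtOp] at h
  exact h

theorem positiveTrace_eq_tsum_sqrtVec {P : H →L[ℂ] H} (hP : P.IsPositive) :
    positiveTrace P = ∑' i, ‖sqrtVec P i‖ₑ ^ 2 := by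
  simp only [positiveTrace, sqrtVec, ← inner_sqrtOp_sqrtOp hP, ofReal_re_inner_self]

theorem positiveTrace_adjoint_mul_self (A : H →L[ℂ] H) :
    positiveTrace (A.adjoint * A) = ∑' i, ‖A (basis H i)‖ₑ ^ 2 := by
  simp only [positiveTrace, mul_apply_eq_comp, ContinuousLinearMap.adjoint_inner_right,
    ofReal_re_inner_self]

theorem positiveTrace_add {P Q : H →L[ℂ] H} (hP : P.IsPositive) (hQ : Q.IsPositive) :
    positiveTrace (P + Q) = positiveTrace P + positiveTrace Q := by
  simp only [positiveTrace, add_apply, inner_add_right, Complex.add_re, ← ENNReal.tsum_add]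
  exact tsum_congr fun i =>
    ENNReal.ofReal_add (hP.re_inner_nonneg_right _) (hQ.re_inner_nonneg_right _)

theorem positiveTrace_smul (P : H →L[ℂ] H) {a : ℝ} (ha : 0 ≤ a) :
    positiveTrace (a • P) = ENNReal.ofReal a * positiveTrace P := by
  simp only [positiveTrace, smul_apply, inner_smul_right_eq_smul, Complex.smul_re, smul_eq_mul,
    ENNReal.ofReal_mul ha, ENNReal.tsum_mul_left]

theorem tsum_ofReal_re_inner_le {P : H →L[ℂ] H} (hP : P.IsPositive) (X : K →L[ℂ] H) {u : ι → K}
    (hu : Orthonormal ℂ u) :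
    ∑' i, ENNReal.ofReal (inner ℂ (X (u i)) (P (X (u i)))).re ≤ ‖X‖ₑ ^ 2 * positiveTrace P := by
  calc ∑' i, ENNReal.ofReal (inner ℂ (X (u i)) (P (X (u i)))).re
      = ∑' i, ‖(sqrtOp P ∘L X) (u i)‖ₑ ^ 2 := by
        simp only [← inner_sqrtOp_sqrtOp hP, ofReal_re_inner_self, ContinuousLinearMap.comp_apply]
    _ ≤ ∑' i, ‖(sqrtOp P ∘L X).adjoint (basis H i)‖ₑ ^ 2 :=
        tsum_sq_enorm_apply_le_adjoint hu (basis H) _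
    _ ≤ ∑' i, ‖X‖ₑ ^ 2 * ‖sqrtVec P i‖ₑ ^ 2 := by
        refine ENNReal.tsum_le_tsum fun i => ?_
        rw [ContinuousLinearMap.adjoint_comp, adjoint_sqrtOp, ← mul_pow,
          ← LinearIsometryEquiv.enorm_map ContinuousLinearMap.adjoint X]
        gcongr
        exact X.adjoint.le_opENorm (sqrtVec P i)
    _ = ‖X‖ₑ ^ 2 * positiveTrace P := by
        rw [ENNReal.tsum_mul_left, positiveTrace_eq_tsum_sqrtVec hP]

theorem opTrace_smul (c : ℂ) (T : H →L[ℂ] H) : opTrace (c • T) = c * opTrace T := by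
  simp only [opTrace, smul_apply, inner_smul_right, tsum_mul_left]

/-- Positive trace class operators, the unnormalised states. -/
structure IsPositiveTraceClass (P : H →L[ℂ] H) : Prop where
  isPositive : P.IsPositive
  positiveTrace_ne_top : positiveTrace P ≠ ⊤

theorem IsState.isPositiveTraceClass {ρ : H →L[ℂ] H} (hρ : IsState ρ) :
    IsPositiveTraceClass ρ :=
  ⟨hρ.1, hρ.2 ▸ ENNReal.one_ne_top⟩

namespace IsPositiveTraceClass

variable {P Q : H →L[ℂ] H}

theorem add (hP : IsPositiveTraceClass P) (hQ : IsPositiveTraceClass Q) :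
    IsPositiveTraceClass (P + Q) where
  isPositive := hP.isPositive.add hQ.isPositive
  positiveTrace_ne_top := by
    rw [positiveTrace_add hP.isPositive hQ.isPositive]
    exact ENNReal.add_ne_top.2 ⟨hP.positiveTrace_ne_top, hQ.positiveTrace_ne_top⟩

theorem smul (hP : IsPositiveTraceClass P) {a : ℝ} (ha : 0 ≤ a) :
    IsPositiveTraceClass (a • P) where
  isPositive := isPositive_smul hP.isPositive ha
  positiveTrace_ne_top := by
    rw [positiveTrace_smul P ha]
    exact ENNReal.mul_ne_top ENNReal.ofReal_ne_top hP.positiveTrace_ne_top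

theorem hasSum_sq_norm_sqrtVec (hP : IsPositiveTraceClass P) :
    HasSum (fun i => ‖sqrtVec P i‖ ^ 2) (positiveTrace P).toReal := by
  have hT := hP.positiveTrace_ne_top
  rw [positiveTrace_eq_tsum_sqrtVec hP.isPositive] at hT ⊢
  rw [ENNReal.tsum_toReal_eq fun _ => ENNReal.pow_ne_top enorm_ne_top]
  simpa only [ENNReal.toReal_pow, toReal_enorm] using ENNReal.hasSum_toReal hT

theorem summable_sq_norm_inner_sqrtVec (hP : IsPositiveTraceClass P) (W : K →L[ℂ] H)
    (c : HilbertBasis κ ℂ K) :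
    Summable fun p : basisIndex H × κ => ‖inner ℂ (W (c p.2)) (sqrtVec P p.1)‖ ^ 2 := by
  have hsum (n : basisIndex H) : HasSum (fun j => ‖inner ℂ (W (c j)) (sqrtVec P n)‖ ^ 2)
      (‖W.adjoint (sqrtVec P n)‖ ^ 2) := by
    simpa only [W.adjoint_inner_right] using hasSum_sq_norm_inner c (W.adjoint (sqrtVec P n))
  refine (summable_prod_of_nonneg fun _ => sq_nonneg _).2 ⟨fun n => (hsum n).summable, ?_⟩
  simp_rw [(hsum _).tsum_eq]
  refine Summable.of_nonneg_of_le (fun _ => sq_nonneg _) (fun n => ?_)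
    (hP.hasSum_sq_norm_sqrtVec.summable.mul_left (‖W.adjoint‖ ^ 2))
  rw [← mul_pow]
  gcongr
  exact W.adjoint.le_opNorm _

theorem summable_inner_mul_inner_sqrtVec (hP : IsPositiveTraceClass P) (V W : K →L[ℂ] H)
    (c : HilbertBasis κ ℂ K) :
    Summable fun p : basisIndex H × κ =>
      inner ℂ (sqrtVec P p.1) (V (c p.2)) * inner ℂ (W (c p.2)) (sqrtVec P p.1) := by
  refine Summable.of_norm_bounded ((hP.summable_sq_norm_inner_sqrtVec V c).add
    (hP.summable_sq_norm_inner_sqrtVec W c)) fun p => ?_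
  rw [norm_mul, norm_inner_symm]
  have := two_mul_le_add_sq ‖inner ℂ (V (c p.2)) (sqrtVec P p.1)‖
    ‖inner ℂ (W (c p.2)) (sqrtVec P p.1)‖
  nlinarith [norm_nonneg (inner ℂ (V (c p.2)) (sqrtVec P p.1)),
    norm_nonneg (inner ℂ (W (c p.2)) (sqrtVec P p.1))]

theorem hasSum_inner_conj_tsum (hP : IsPositiveTraceClass P) (V W : K →L[ℂ] H)
    (c : HilbertBasis κ ℂ K) :
    HasSum (fun j => inner ℂ (W (c j)) (P (V (c j))))
      (∑' n, inner ℂ (V.adjoint (sqrtVec P n)) (W.adjoint (sqrtVec P n))) := by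
  have hs := hP.summable_inner_mul_inner_sqrtVec V W c
  have hrow (n : basisIndex H) : HasSum (fun j => inner ℂ (sqrtVec P n) (V (c j)) *
      inner ℂ (W (c j)) (sqrtVec P n))
      (inner ℂ (V.adjoint (sqrtVec P n)) (W.adjoint (sqrtVec P n))) := by
    simpa only [ContinuousLinearMap.adjoint_inner_right, ContinuousLinearMap.adjoint_inner_left]
      using c.hasSum_inner_mul_inner (V.adjoint (sqrtVec P n)) (W.adjoint (sqrtVec P n))
  have hcol (j : κ) : HasSum (fun n => inner ℂ (sqrtVec P n) (V (c j)) *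
      inner ℂ (W (c j)) (sqrtVec P n)) (inner ℂ (W (c j)) (P (V (c j)))) := by
    simpa only [mul_comm] using hasSum_inner_sqrtVec hP.isPositive (W (c j)) (V (c j))
  rw [(hs.hasSum.prod_fiberwise hrow).tsum_eq]
  exact ((Equiv.prodComm _ _).hasSum_iff.2 hs.hasSum).prod_fiberwise hcol

theorem opTrace_mul (hP : IsPositiveTraceClass P) (O : H →L[ℂ] H) :
    opTrace (P * O) = ∑' n, inner ℂ (sqrtVec P n) (O (sqrtVec P n)) := by
  have h := (hP.hasSum_inner_conj_tsum O 1 (basis H)).tsum_eq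
  simp_rw [ContinuousLinearMap.adjoint_inner_right, one_apply_eq_self, O.adjoint_inner_left] at h
  exact h

theorem hasSum_inner_conj (hP : IsPositiveTraceClass P) (V W : K →L[ℂ] H)
    (c : HilbertBasis κ ℂ K) :
    HasSum (fun j => inner ℂ (W (c j)) (P (V (c j)))) (opTrace (P * (V ∘L W.adjoint))) := by
  rw [hP.opTrace_mul]
  simpa only [ContinuousLinearMap.comp_apply, V.adjoint_inner_left] using
    hP.hasSum_inner_conj_tsum V W c

theorem hasSum_opTrace_mul (hP : IsPositiveTraceClass P) (O : H →L[ℂ] H) :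
    HasSum (fun i => inner ℂ (basis H i) ((P * O) (basis H i))) (opTrace (P * O)) :=
  (hP.hasSum_inner_conj_tsum O 1 (basis H)).summable.hasSum

theorem opTrace_add_mul (hP : IsPositiveTraceClass P) (hQ : IsPositiveTraceClass Q)
    (O : H →L[ℂ] H) : opTrace ((P + Q) * O) = opTrace (P * O) + opTrace (Q * O) := by
  refine HasSum.tsum_eq ?_
  simpa only [add_mul, add_apply, inner_add_right] using
    (hP.hasSum_opTrace_mul O).add (hQ.hasSum_opTrace_mul O)

theorem opTrace_mul_sum (hP : IsPositiveTraceClass P) (s : Finset ι) (O : ι → H →L[ℂ] H) :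
    opTrace (P * ∑ i ∈ s, O i) = ∑ i ∈ s, opTrace (P * O i) := by
  refine HasSum.tsum_eq ?_
  simpa only [Finset.mul_sum, sum_apply, inner_sum] using
    hasSum_sum fun i (_ : i ∈ s) => hP.hasSum_opTrace_mul (O i)

theorem opTrace_mul_adjoint (hP : IsPositiveTraceClass P) (O : H →L[ℂ] H) :
    opTrace (P * O.adjoint) = starRingEnd ℂ (opTrace (P * O)) := by
  simp only [hP.opTrace_mul, Complex.conj_tsum, O.adjoint_inner_right, inner_conj_symm]

theorem norm_opTrace_mul_le (hP : IsPositiveTraceClass P) (O : H →L[ℂ] H) :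
    ‖opTrace (P * O)‖ ≤ (positiveTrace P).toReal * ‖O‖ := by
  rw [hP.opTrace_mul]
  refine tsum_of_norm_bounded (hP.hasSum_sq_norm_sqrtVec.mul_right ‖O‖) fun n => ?_
  calc ‖inner ℂ (sqrtVec P n) (O (sqrtVec P n))‖ ≤ ‖sqrtVec P n‖ * ‖O (sqrtVec P n)‖ :=
        norm_inner_le_norm _ _
    _ ≤ ‖sqrtVec P n‖ * (‖O‖ * ‖sqrtVec P n‖) := by gcongr; exact O.le_opNorm _
    _ = ‖sqrtVec P n‖ ^ 2 * ‖O‖ := by ring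

end IsPositiveTraceClass

theorem isPositive_posPart (T : H →L[ℂ] H) : (T⁺).IsPositive :=
  (T⁺).nonneg_iff_isPositive.1 (CFC.posPart_nonneg T)

theorem isPositive_negPart (T : H →L[ℂ] H) : (T⁻).IsPositive :=
  (T⁻).nonneg_iff_isPositive.1 (CFC.negPart_nonneg T)

theorem isPositive_abs (T : H →L[ℂ] H) : (CFC.abs T).IsPositive :=
  (CFC.abs T).nonneg_iff_isPositive.1 (CFC.abs_nonneg T)

theorem re_inner_le_re_inner_abs {T : H →L[ℂ] H} (hT : IsSelfAdjoint T) (x : H) :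
    (inner ℂ x (T x)).re ≤ (inner ℂ x (CFC.abs T x)).re := by
  have h : (CFC.abs T - T).IsPositive := by
    rw [CFC.abs_sub_self T, two_smul]
    exact (isPositive_negPart T).add (isPositive_negPart T)
  have hx := h.re_inner_nonneg_right x
  rwa [sub_apply, inner_sub_right, map_sub, sub_nonneg] at hx

theorem traceNorm_zero : traceNorm (0 : H →L[ℂ] H) = 0 := by
  simp [traceNorm, positiveTrace]

theorem traceNorm_eq_add {T : H →L[ℂ] H} (hT : IsSelfAdjoint T) :
    traceNorm T = positiveTrace T⁺ + positiveTrace T⁻ := by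
  rw [traceNorm, ← CFC.posPart_add_negPart T hT,
    positiveTrace_add (isPositive_posPart T) (isPositive_negPart T)]

theorem norm_opTrace_mul_sub_le {P Q : H →L[ℂ] H} (hP : IsPositiveTraceClass P)
    (hQ : IsPositiveTraceClass Q) (hPQ : traceNorm (P - Q) ≠ ⊤) (O : H →L[ℂ] H) :
    ‖opTrace (P * O) - opTrace (Q * O)‖ ≤ (traceNorm (P - Q)).toReal * ‖O‖ := by
  have hsa : IsSelfAdjoint (P - Q) := hP.isPositive.isSelfAdjoint.sub hQ.isPositive.isSelfAdjoint
  rw [traceNorm_eq_add hsa] at hPQ ⊢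
  obtain ⟨hpos_top, hneg_top⟩ := ENNReal.add_ne_top.1 hPQ
  have hpos : IsPositiveTraceClass (P - Q)⁺ := ⟨isPositive_posPart _, hpos_top⟩
  have hneg : IsPositiveTraceClass (P - Q)⁻ := ⟨isPositive_negPart _, hneg_top⟩
  have hdecomp : P + (P - Q)⁻ = Q + (P - Q)⁺ := by
    rw [add_comm Q, ← sub_eq_sub_iff_add_eq_add, CFC.posPart_sub_negPart (P - Q) hsa]
  have htrace : opTrace (P * O) - opTrace (Q * O) =
      opTrace ((P - Q)⁺ * O) - opTrace ((P - Q)⁻ * O) := by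
    have h := hP.opTrace_add_mul hneg O
    rw [hdecomp, hQ.opTrace_add_mul hpos O] at h
    linear_combination -h
  rw [htrace, ENNReal.toReal_add hpos_top hneg_top, add_mul]
  exact (norm_sub_le _ _).trans
    (add_le_add (hpos.norm_opTrace_mul_le O) (hneg.norm_opTrace_mul_le O))

end Trace

/-! ### The tensor product of two mode spaces -/

section Tensor

variable {m : ℕ} {ι κ : Type*}

theorem ext_hilbertBasis {𝕜 H F : Type*} [RCLike 𝕜] [NormedAddCommGroup H] [InnerProductSpace 𝕜 H]
    [NormedAddCommGroup F] [NormedSpace 𝕜 F] (b : HilbertBasis ι 𝕜 H) {S T : H →L[𝕜] F}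
    (h : ∀ i, S (b i) = T (b i)) : S = T := by
  refine ContinuousLinearMap.ext_on
    (Submodule.dense_iff_topologicalClosure_eq_top.2 b.dense_span) ?_
  rintro _ ⟨i, rfl⟩
  exact h i

/-- The product vector `productVector f g`, as a bounded bilinear function of `f` and `g`. -/
def productVectorL (m : ℕ) : ModeSpace m →L[ℂ] ModeSpace m →L[ℂ] Bipartite m :=
  (ContinuousLinearMap.compL ℂ (ModeSpace m) (ModeSpace m ⊗[ℂ] ModeSpace m) (Bipartite m)
    UniformSpace.Completion.toComplL) ∘L (TensorProduct.mkL ℂ (ModeSpace m) (ModeSpace m))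

theorem productVectorL_apply (f g : ModeSpace m) : productVectorL m f g = productVector f g := rfl

theorem inner_productVector (f g f' g' : ModeSpace m) :
    inner ℂ (productVector f g) (productVector f' g') = inner ℂ f f' * inner ℂ g g' := by
  rw [productVector, productVector, UniformSpace.Completion.inner_coe, TensorProduct.inner_tmul]

theorem norm_productVector (f g : ModeSpace m) : ‖productVector f g‖ = ‖f‖ * ‖g‖ := by
  rw [productVector, UniformSpace.Completion.norm_coe, TensorProduct.norm_tmul]

theorem dense_span_productVector :
    Dense (Submodule.span ℂ {x : Bipartite m | ∃ f g, productVector f g = x} :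
      Set (Bipartite m)) := by
  refine (UniformSpace.Completion.denseRange_coe (α := ModeSpace m ⊗[ℂ] ModeSpace m)).mono ?_
  rintro _ ⟨x, rfl⟩
  induction x using TensorProduct.induction_on with
  | zero => exact Submodule.zero_mem _
  | tmul f g => exact Submodule.subset_span ⟨f, g, rfl⟩
  | add x y hx hy =>
    rw [UniformSpace.Completion.coe_add]
    exact Submodule.add_mem _ hx hy

theorem ext_productVector {F : Type*} [NormedAddCommGroup F] [NormedSpace ℂ F]
    {S T : Bipartite m →L[ℂ] F} (h : ∀ f g, S (productVector f g) = T (productVector f g)) :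
    S = T := by
  refine ContinuousLinearMap.ext_on dense_span_productVector ?_
  rintro _ ⟨f, g, rfl⟩
  exact h f g

theorem ext_inner_productVector {x y : Bipartite m}
    (h : ∀ f g, inner ℂ x (productVector f g) = inner ℂ y (productVector f g)) : x = y :=
  (InnerProductSpace.toDualMap ℂ (Bipartite m)).injective (ext_productVector h)

theorem orthonormal_productVector {b : ι → ModeSpace m} {b' : κ → ModeSpace m}
    (hb : Orthonormal ℂ b) (hb' : Orthonormal ℂ b') :
    Orthonormal ℂ fun p : ι × κ => productVector (b p.1) (b' p.2) :=
  (hb.tmul hb').comp_linearIsometry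
    (UniformSpace.Completion.toComplₗᵢ (𝕜 := ℂ) (E := ModeSpace m ⊗[ℂ] ModeSpace m))

/-- The product of two orthonormal bases, which is an orthonormal basis of the tensor product. -/
def productBasis (b : HilbertBasis ι ℂ (ModeSpace m)) (b' : HilbertBasis κ ℂ (ModeSpace m)) :
    HilbertBasis (ι × κ) ℂ (Bipartite m) :=
  HilbertBasis.mkOfOrthogonalEqBot (orthonormal_productVector b.orthonormal b'.orthonormal) <| by
    refine (Submodule.eq_bot_iff _).2 fun x hx => ext_inner_productVector fun f g => ?_
    have hbasis (i : ι) (j : κ) : inner ℂ x (productVector (b i) (b' j)) = 0 :=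
      (Submodule.mem_orthogonal' _ _).1 hx _ (Submodule.subset_span ⟨(i, j), rfl⟩)
    have hleft (i : ι) : innerSL ℂ x ∘L productVectorL m (b i) = 0 :=
      ext_hilbertBasis b' (hbasis i)
    have hright : innerSL ℂ x ∘L (productVectorL m).flip g = 0 :=
      ext_hilbertBasis b fun i => DFunLike.congr_fun (hleft i) g
    rw [inner_zero_left]
    exact DFunLike.congr_fun hright f

theorem productBasis_apply (b : HilbertBasis ι ℂ (ModeSpace m))
    (b' : HilbertBasis κ ℂ (ModeSpace m)) (p : ι × κ) :
    productBasis b b' p = productVector (b p.1) (b' p.2) := by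
  rw [productBasis, HilbertBasis.coe_mkOfOrthogonalEqBot]

theorem tensorOp_productVector (S T : ModeSpace m →L[ℂ] ModeSpace m) (f g : ModeSpace m) :
    tensorOp S T (productVector f g) = productVector (S f) (T g) := by
  rw [tensorOp, productVector, ContinuousLinearMap.completion_apply_coe, TensorProduct.mapL_tmul]
  rfl

theorem tensorOp_mul (S S' T T' : ModeSpace m →L[ℂ] ModeSpace m) :
    tensorOp S T * tensorOp S' T' = tensorOp (S * S') (T * T') :=
  ext_productVector fun f g => by
    simp only [mul_apply_eq_comp, tensorOp_productVector]

theorem tensorOp_smul_smul (a b : ℂ) (S T : ModeSpace m →L[ℂ] ModeSpace m) :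
    tensorOp (a • S) (b • T) = (a * b) • tensorOp S T :=
  ext_productVector fun f g => by
    simp only [smul_apply, tensorOp_productVector]
    simp only [← productVectorL_apply, map_smul, smul_apply, smul_smul, mul_comm]

theorem adjoint_tensorOp (S T : ModeSpace m →L[ℂ] ModeSpace m) :
    (tensorOp S T).adjoint = tensorOp S.adjoint T.adjoint := by
  refine ext_productVector fun f g => ext_inner_productVector fun f' g' => ?_
  simp only [ContinuousLinearMap.adjoint_inner_left, tensorOp_productVector, inner_productVector]

theorem norm_tensorOp_le (S T : ModeSpace m →L[ℂ] ModeSpace m) :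
    ‖tensorOp S T‖ ≤ ‖S‖ * ‖T‖ := by
  refine ContinuousLinearMap.opNorm_le_bound _ (by positivity) fun x => ?_
  induction x using UniformSpace.Completion.induction_on with
  | hp => exact isClosed_le (by fun_prop) (by fun_prop)
  | ih x =>
    rw [tensorOp, ContinuousLinearMap.completion_apply_coe, UniformSpace.Completion.norm_coe,
      UniformSpace.Completion.norm_coe]
    exact (ContinuousLinearMap.le_opNorm _ _).trans
      (mul_le_mul_of_nonneg_right (TensorProduct.norm_mapL_le S T) (norm_nonneg _))

theorem adjoint_tensorOp_sqrtOp_mul_self {S T : ModeSpace m →L[ℂ] ModeSpace m} (hS : S.IsPositive)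
    (hT : T.IsPositive) :
    (tensorOp (sqrtOp S) (sqrtOp T)).adjoint * tensorOp (sqrtOp S) (sqrtOp T) =
      tensorOp S T := by
  rw [adjoint_tensorOp, adjoint_sqrtOp, adjoint_sqrtOp, tensorOp_mul, sqrtOp_mul_self hS,
    sqrtOp_mul_self hT]

theorem isPositive_tensorOp {S T : ModeSpace m →L[ℂ] ModeSpace m} (hS : S.IsPositive)
    (hT : T.IsPositive) : (tensorOp S T).IsPositive := by
  rw [← adjoint_tensorOp_sqrtOp_mul_self hS hT]
  exact ContinuousLinearMap.isPositive_adjoint_comp_self _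

theorem positiveTrace_tensorOp {S T : ModeSpace m →L[ℂ] ModeSpace m} (hS : S.IsPositive)
    (hT : T.IsPositive) : positiveTrace (tensorOp S T) = positiveTrace S * positiveTrace T := by
  let b := basis (ModeSpace m)
  calc positiveTrace (tensorOp S T)
      = ∑' i, ‖tensorOp (sqrtOp S) (sqrtOp T) (basis (Bipartite m) i)‖ₑ ^ 2 := by
        rw [← adjoint_tensorOp_sqrtOp_mul_self hS hT, positiveTrace_adjoint_mul_self]
    _ = ∑' p, ‖tensorOp (sqrtOp S) (sqrtOp T) (productBasis b b p)‖ₑ ^ 2 := by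
        rw [tsum_sq_enorm_apply_eq_adjoint _ (productBasis b b), adjoint_tensorOp, adjoint_sqrtOp,
          adjoint_sqrtOp]
    _ = ∑' i, ∑' j, ‖sqrtVec S i‖ₑ ^ 2 * ‖sqrtVec T j‖ₑ ^ 2 := by
        rw [ENNReal.tsum_prod']
        refine tsum_congr fun i => tsum_congr fun j => ?_
        rw [productBasis_apply, tensorOp_productVector, ← ofReal_norm, norm_productVector,
          ENNReal.ofReal_mul (norm_nonneg _), ofReal_norm, ofReal_norm, mul_pow]
        rfl
    _ = positiveTrace S * positiveTrace T := by
        simp_rw [ENNReal.tsum_mul_left, ENNReal.tsum_mul_right, positiveTrace_eq_tsum_sqrtVec hS,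
          positiveTrace_eq_tsum_sqrtVec hT]

protected theorem IsPositiveTraceClass.tensorOp {S T : ModeSpace m →L[ℂ] ModeSpace m}
    (hS : IsPositiveTraceClass S) (hT : IsPositiveTraceClass T) :
    IsPositiveTraceClass (tensorOp S T) where
  isPositive := isPositive_tensorOp hS.isPositive hT.isPositive
  positiveTrace_ne_top := by
    rw [positiveTrace_tensorOp hS.isPositive hT.isPositive]
    exact ENNReal.mul_ne_top hS.positiveTrace_ne_top hT.positiveTrace_ne_top

end Tensor

/-! ### Complex conjugation and the partial transpose -/

section Conjugation

variable {m : ℕ} {ι : Type*}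

theorem inner_star_star (f g : ModeSpace m) : inner ℂ (star f) (star g) = inner ℂ g f := by
  rw [L2.inner_def, L2.inner_def]
  refine integral_congr_ae ?_
  filter_upwards [Lp.coeFn_star f, Lp.coeFn_star g] with x hf hg
  rw [hf, hg, Pi.star_apply, Pi.star_apply]
  simp [mul_comm]

variable (m) in
/-- Complex conjugation of wave functions, as an antiunitary operator. -/
def conjugation : ModeSpace m ≃ₗᵢ⋆[ℂ] ModeSpace m where
  toFun := star
  invFun := star
  left_inv := star_star
  right_inv := star_star
  map_add' f g := by
    refine Lp.ext ?_
    filter_upwards [Lp.coeFn_star (f + g), Lp.coeFn_star f, Lp.coeFn_star g, Lp.coeFn_add f g,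
      Lp.coeFn_add (star f) (star g)] with x hsum_star hf hg hsum hstar_sum
    rw [hsum_star, hstar_sum, Pi.add_apply, hf, hg, Pi.star_apply, hsum, Pi.add_apply, star_add]
    rfl
  map_smul' c f := by
    refine Lp.ext ?_
    filter_upwards [Lp.coeFn_star (c • f), Lp.coeFn_star f, Lp.coeFn_smul c f,
      Lp.coeFn_smul (starRingEnd ℂ c) (star f)] with x hsmul_star hf hsmul hstar_smul
    rw [hsmul_star, hstar_smul, Pi.smul_apply, hf]
    simp [hsmul]
  norm_map' f := by
    have h := congrArg Complex.re (inner_star_star f f)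
    rw [inner_self_eq_norm_sq_to_K, inner_self_eq_norm_sq_to_K] at h
    norm_cast at h
    exact (pow_left_inj₀ (norm_nonneg _) (norm_nonneg _) two_ne_zero).1 h

theorem orthonormal_star {b : ι → ModeSpace m} (hb : Orthonormal ℂ b) :
    Orthonormal ℂ fun i => star (b i) := by
  refine ⟨fun i => ((conjugation m).norm_map _).trans (hb.1 i), fun i j hij => ?_⟩
  exact (inner_star_star _ _).trans (hb.2 hij.symm)

/-- The operator `f ↦ (T f*)*`, the transpose of `T` in the position basis if `T` is
self-adjoint. -/
def conjOp (T : ModeSpace m →L[ℂ] ModeSpace m) : ModeSpace m →L[ℂ] ModeSpace m :=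
  (conjugation m).toContinuousLinearEquiv.toContinuousLinearMap.comp
    (T.comp (conjugation m).toContinuousLinearEquiv.toContinuousLinearMap)

theorem conjOp_apply (T : ModeSpace m →L[ℂ] ModeSpace m) (f : ModeSpace m) :
    conjOp T f = star (T (star f)) := rfl

theorem inner_conjOp (T : ModeSpace m →L[ℂ] ModeSpace m) (f g : ModeSpace m) :
    inner ℂ f (conjOp T g) = inner ℂ (T (star g)) (star f) := by
  rw [conjOp_apply, ← inner_star_star, star_star]

theorem isPositive_conjOp {T : ModeSpace m →L[ℂ] ModeSpace m} (hT : T.IsPositive) :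
    (conjOp T).IsPositive := by
  refine (ContinuousLinearMap.isPositive_iff_complex _).2 fun g => ?_
  rw [← inner_conj_symm, inner_conjOp, inner_conj_symm, ← hT.isSelfAdjoint.adjoint_eq,
    T.adjoint_inner_right]
  exact T.isPositive_iff_complex.1 hT (star g)

end Conjugation

section Transpose

variable {m : ℕ}

namespace IsPartialTranspose

variable {T S T' S' : Bipartite m →L[ℂ] Bipartite m}

theorem add (h : IsPartialTranspose T S) (h' : IsPartialTranspose T' S') :
    IsPartialTranspose (T + T') (S + S') := fun f f' g g' => by
  simp only [add_apply, inner_add_right, h f f' g g', h' f f' g g']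

theorem smul (h : IsPartialTranspose T S) (a : ℝ) : IsPartialTranspose (a • T) (a • S) :=
  fun f f' g g' => by
    rw [smul_apply, smul_apply, inner_smul_right_eq_smul, inner_smul_right_eq_smul, h f f' g g']

theorem isSelfAdjoint (h : IsPartialTranspose T S) (hT : IsSelfAdjoint T) : IsSelfAdjoint S := by
  refine ContinuousLinearMap.isSelfAdjoint_iff'.2 <|
    ext_productVector fun f g => ext_inner_productVector fun f' g' => ?_
  rw [ContinuousLinearMap.adjoint_inner_left, h, ← inner_conj_symm (S _), h, inner_conj_symm,
    ← hT.adjoint_eq, T.adjoint_inner_right, hT.adjoint_eq]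

end IsPartialTranspose

theorem isPartialTranspose_tensorOp (S : ModeSpace m →L[ℂ] ModeSpace m)
    {T : ModeSpace m →L[ℂ] ModeSpace m} (hT : IsSelfAdjoint T) :
    IsPartialTranspose (tensorOp S T) (tensorOp S (conjOp T)) := by
  intro f f' g g'
  rw [tensorOp_productVector, tensorOp_productVector, inner_productVector, inner_productVector,
    inner_conjOp, ← ContinuousLinearMap.adjoint_inner_right, hT.adjoint_eq]

/-- The exchange of the two parties. -/
def swapOp (m : ℕ) : Bipartite m →L[ℂ] Bipartite m :=
  ContinuousLinearMap.completion (LinearIsometry.toContinuousLinearMap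
    (TensorProduct.commIsometry ℂ (ModeSpace m) (ModeSpace m)).toLinearIsometry)

theorem swapOp_productVector (f g : ModeSpace m) :
    swapOp m (productVector f g) = productVector g f := by
  rw [swapOp, productVector, ContinuousLinearMap.completion_apply_coe]
  rfl

/-- The operator `g ↦ ∫ φ(·, y) g(y) dy` whose kernel is the wave function `φ` of `A` and `B`, that
is, `⟨f, R g⟩ = ⟨f ⊗ g*, φ⟩`. -/
def vecOp (φ : Bipartite m) : ModeSpace m →L[ℂ] ModeSpace m :=
  (ContinuousLinearMap.apply ℂ (ModeSpace m) φ).comp <|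
    ContinuousLinearMap.adjoint.toContinuousLinearEquiv.toContinuousLinearMap.comp <|
      (productVectorL m).flip.comp (conjugation m).toContinuousLinearEquiv.toContinuousLinearMap

theorem vecOp_apply (φ : Bipartite m) (g : ModeSpace m) :
    vecOp φ g = ((productVectorL m).flip (star g)).adjoint φ := rfl

theorem inner_vecOp (φ : Bipartite m) (f g : ModeSpace m) :
    inner ℂ f (vecOp φ g) = inner ℂ (productVector f (star g)) φ := by
  rw [vecOp_apply, ContinuousLinearMap.adjoint_inner_right]
  rfl

theorem norm_vecOp_le (φ : Bipartite m) : ‖vecOp φ‖ ≤ ‖φ‖ := by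
  refine ContinuousLinearMap.opNorm_le_bound _ (norm_nonneg φ) fun g => ?_
  have hflip : ‖(productVectorL m).flip (star g)‖ ≤ ‖g‖ := by
    refine ContinuousLinearMap.opNorm_le_bound _ (norm_nonneg g) fun f => ?_
    rw [ContinuousLinearMap.flip_apply, productVectorL_apply, norm_productVector, mul_comm]
    exact (congrArg (· * ‖f‖) ((conjugation m).norm_map g)).le
  rw [vecOp_apply, mul_comm]
  refine (ContinuousLinearMap.le_opNorm _ _).trans ?_
  rw [LinearIsometryEquiv.norm_map]
  gcongr

/-- The partial transpose of the rank one operator `|φ⟩⟨φ|`: its matrix element between `f ⊗ g` and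
`f' ⊗ g'` is `⟨f ⊗ g'*, φ⟩⟨φ, f' ⊗ g*⟩`, whose factors involve the pairs `(f, g')` and `(f', g)`;
this is the reason for the exchange operator. -/
def transposedProjection (φ : Bipartite m) : Bipartite m →L[ℂ] Bipartite m :=
  tensorOp (vecOp φ) (vecOp φ).adjoint ∘L swapOp m

theorem inner_transposedProjection (φ : Bipartite m) (f g f' g' : ModeSpace m) :
    inner ℂ (productVector f g) (transposedProjection φ (productVector f' g')) =
      inner ℂ (productVector f (star g')) φ * inner ℂ φ (productVector f' (star g)) := by
  rw [transposedProjection, ContinuousLinearMap.comp_apply, swapOp_productVector,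
    tensorOp_productVector, inner_productVector, inner_vecOp,
    ContinuousLinearMap.adjoint_inner_right, ← inner_conj_symm (vecOp φ g), inner_vecOp,
    inner_conj_symm]

theorem norm_transposedProjection_le (φ : Bipartite m) :
    ‖transposedProjection φ‖ ≤ ‖φ‖ ^ 2 * ‖swapOp m‖ := by
  refine (ContinuousLinearMap.opNorm_comp_le _ _).trans ?_
  gcongr
  refine (norm_tensorOp_le _ _).trans ?_
  rw [LinearIsometryEquiv.norm_map, ← sq]
  gcongr
  exact norm_vecOp_le φ

theorem hasSum_inner_tsum_apply {ι 𝕜 H : Type*} [RCLike 𝕜] [NormedAddCommGroup H]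
    [InnerProductSpace 𝕜 H] [CompleteSpace H] {R : ι → H →L[𝕜] H} {r : ι → ℝ}
    (hr : Summable r) (hR : ∀ i, ‖R i‖ ≤ r i) (x y : H) :
    HasSum (fun i => inner 𝕜 x (R i y)) (inner 𝕜 x ((∑' i, R i) y)) :=
  ((Summable.of_norm_bounded hr hR).hasSum.mapL (ContinuousLinearMap.apply 𝕜 H y)).mapL
    (innerSL 𝕜 x)

theorem IsPositiveTraceClass.isPartialTranspose_tsum {P : Bipartite m →L[ℂ] Bipartite m}
    (hP : IsPositiveTraceClass P) :
    IsPartialTranspose P (∑' i, transposedProjection (sqrtVec P i)) := by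
  intro f f' g g'
  have h := hasSum_inner_tsum_apply (hP.hasSum_sq_norm_sqrtVec.summable.mul_right ‖swapOp m‖)
    (fun i => norm_transposedProjection_le (sqrtVec P i)) (productVector f g)
    (productVector f' g')
  rw [← h.tsum_eq, ← (hasSum_inner_sqrtVec hP.isPositive _ _).tsum_eq]
  exact tsum_congr fun i => inner_transposedProjection _ _ _ _ _

theorem IsPositiveTraceClass.isPartialTranspose {P : Bipartite m →L[ℂ] Bipartite m}
    (hP : IsPositiveTraceClass P) : IsPartialTranspose P (partialTranspose P) := by
  have h : ∃ S, IsPartialTranspose P S := ⟨_, hP.isPartialTranspose_tsum⟩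
  rw [partialTranspose, dif_pos h]
  exact h.choose_spec

/-- Positive trace class operators with a positive partial transpose, the cone over PPT. -/
def positivePT (m : ℕ) : Set (Bipartite m →L[ℂ] Bipartite m) :=
  {τ | IsPositiveTraceClass τ ∧ ∃ S, S.IsPositive ∧ IsPartialTranspose τ S}

theorem convex_positivePT : Convex ℝ (positivePT m) := by
  rintro P ⟨hP, S, hS, hPS⟩ Q ⟨hQ, S', hS', hQS⟩ a b ha hb -
  exact ⟨(hP.smul ha).add (hQ.smul hb), a • S + b • S',
    (isPositive_smul hS ha).add (isPositive_smul hS' hb), (hPS.smul a).add (hQS.smul b)⟩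

theorem productStates_subset_positivePT : productStates m ⊆ positivePT m := by
  rintro _ ⟨ρA, ρB, hA, hB, rfl⟩
  exact ⟨hA.isPositiveTraceClass.tensorOp hB.isPositiveTraceClass, tensorOp ρA (conjOp ρB),
    isPositive_tensorOp hA.1 (isPositive_conjOp hB.1),
    isPartialTranspose_tensorOp ρA hB.1.isSelfAdjoint⟩

end Transpose

/-! ### The Weyl relations -/

section Displacement

variable {m : ℕ}

variable (m) in
/-- The symplectic product `∑ₖ Im (ξₖ ηₖ*)` on `ℂᵐ`, the phase in the Weyl relations. -/
def symplecticProduct : (Fin m → ℂ) →ₗ[ℝ] (Fin m → ℂ) →ₗ[ℝ] ℝ :=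
  LinearMap.mk₂ ℝ (fun ξ η => ∑ k, (ξ k * starRingEnd ℂ (η k)).im)
    (fun ξ ξ' η => by simp only [Pi.add_apply, add_mul, Complex.add_im, Finset.sum_add_distrib])
    (fun c ξ η => by
      simp only [Pi.smul_apply, smul_mul_assoc, Complex.smul_im, Finset.smul_sum])
    (fun ξ η η' => by
      simp only [Pi.add_apply, map_add, mul_add, Complex.add_im, Finset.sum_add_distrib])
    (fun c ξ η => by simp [Finset.mul_sum, mul_add, mul_left_comm])

theorem symplecticProduct_apply (ξ η : Fin m → ℂ) :
    symplecticProduct m ξ η = ∑ k, (ξ k * starRingEnd ℂ (η k)).im := rfl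

theorem symplecticProduct_self (ξ : Fin m → ℂ) : symplecticProduct m ξ ξ = 0 := by
  simp only [symplecticProduct_apply, Complex.mul_conj, Complex.ofReal_im, Finset.sum_const_zero]

theorem symplecticProduct_swap (ξ η : Fin m → ℂ) :
    symplecticProduct m η ξ = -symplecticProduct m ξ η := by
  rw [symplecticProduct_apply, symplecticProduct_apply, ← Finset.sum_neg_distrib]
  refine Finset.sum_congr rfl fun k _ => ?_
  simp only [Complex.mul_im, Complex.conj_re, Complex.conj_im]
  ring

theorem coeFn_displacement (ξ : Fin m → ℂ) (f : ModeSpace m) :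
    displacement ξ f =ᵐ[volume] displaceFun ξ f :=
  (memLp_displaceFun ξ f).coeFn_toLp

theorem norm_displacement_apply (ξ : Fin m → ℂ) (f : ModeSpace m) : ‖displacement ξ f‖ = ‖f‖ := by
  change ‖(memLp_displaceFun ξ f).toLp (displaceFun ξ f)‖ = ‖f‖
  rw [Lp.norm_toLp, eLpNorm_displaceFun, Lp.norm_def]

theorem norm_displacement_le (ξ : Fin m → ℂ) : ‖displacement ξ‖ ≤ 1 :=
  LinearIsometry.norm_toContinuousLinearMap_le _

theorem displaceFun_congr_ae (ξ : Fin m → ℂ) {f g : (Fin m → ℝ) → ℂ} (h : f =ᵐ[volume] g) :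
    displaceFun ξ f =ᵐ[volume] displaceFun ξ g := by
  filter_upwards [(measurePreserving_shift ξ).quasiMeasurePreserving.ae h] with x hx
  rw [displaceFun, displaceFun, hx]

theorem displaceFun_displaceFun (ξ η : Fin m → ℂ) (f : (Fin m → ℝ) → ℂ) (x : Fin m → ℝ) :
    displaceFun ξ (displaceFun η f) x =
      Complex.exp (symplecticProduct m ξ η * Complex.I) * displaceFun (ξ + η) f x := by
  have hshift : (fun k => x k - √2 * (ξ k).re - √2 * (η k).re) =
      fun k => x k - √2 * ((ξ + η) k).re := by
    ext k
    rw [Pi.add_apply, Complex.add_re]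
    ring
  simp only [displaceFun, hshift, ← mul_assoc, ← Complex.exp_add, mul_comm _ Complex.I, ← mul_add,
    ← Complex.ofReal_add, symplecticProduct_apply, ← Finset.sum_add_distrib]
  congr 4
  refine Finset.sum_congr rfl fun k _ => ?_
  simp only [Pi.add_apply, Complex.add_re, Complex.add_im, Complex.mul_im, Complex.conj_re,
    Complex.conj_im]
  linear_combination (-(η k).im * (ξ k).re) * Real.mul_self_sqrt zero_le_two

theorem displacement_mul (ξ η : Fin m → ℂ) :
    displacement ξ * displacement η =
      Complex.exp (symplecticProduct m ξ η * Complex.I) • displacement (ξ + η) := by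
  ext1 f
  refine Lp.ext ?_
  rw [smul_apply, mul_apply_eq_comp]
  filter_upwards [coeFn_displacement ξ (displacement η f), coeFn_displacement (ξ + η) f,
    displaceFun_congr_ae ξ (coeFn_displacement η f),
    Lp.coeFn_smul (Complex.exp (symplecticProduct m ξ η * Complex.I)) (displacement (ξ + η) f)]
    with x hξ hsum hη hsmul
  rw [hξ, hη, hsmul, Pi.smul_apply, hsum, smul_eq_mul, displaceFun_displaceFun]

theorem displacement_zero : displacement (0 : Fin m → ℂ) = 1 := by
  ext1 f
  refine Lp.ext ?_
  filter_upwards [coeFn_displacement 0 f] with x hx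
  simp [hx, displaceFun]

theorem displacement_mul_neg (ξ : Fin m → ℂ) : displacement ξ * displacement (-ξ) = 1 := by
  rw [displacement_mul, add_neg_cancel, displacement_zero, map_neg, symplecticProduct_self]
  simp

theorem adjoint_displacement (ξ : Fin m → ℂ) : (displacement ξ).adjoint = displacement (-ξ) := by
  have h : (displacement ξ).adjoint * displacement ξ = 1 :=
    (ContinuousLinearMap.norm_map_iff_adjoint_comp_self _).1 (norm_displacement_apply ξ)
  exact left_inv_eq_right_inv h (displacement_mul_neg ξ)

theorem star_displacement (ξ : Fin m → ℂ) (f : ModeSpace m) :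
    star (displacement ξ f) = displacement (star ξ) (star f) := by
  refine Lp.ext ?_
  filter_upwards [coeFn_displacement ξ f, coeFn_displacement (star ξ) (star f),
    displaceFun_congr_ae (star ξ) (Lp.coeFn_star f), Lp.coeFn_star (displacement ξ f)]
    with x hξ hstar hf hstar'
  rw [hstar', hstar, hf, Pi.star_apply, hξ]
  simp only [displaceFun, star_mul', Pi.star_apply, RCLike.star_def, ← Complex.exp_conj, map_mul,
    Complex.conj_I, Complex.conj_ofReal, Complex.conj_re, Complex.conj_im, neg_mul, ← mul_neg,
    ← Complex.ofReal_neg, ← Finset.sum_neg_distrib]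
  congr 5
  ext k
  ring

theorem displacement_mul_adjoint (ξ η : Fin m → ℂ) :
    displacement ξ * (displacement η).adjoint =
      Complex.exp (-symplecticProduct m ξ η * Complex.I) • displacement (ξ - η) := by
  rw [adjoint_displacement, displacement_mul, ← sub_eq_add_neg, map_neg, Complex.ofReal_neg]

theorem adjoint_mul_displacement (ξ η : Fin m → ℂ) :
    (displacement η).adjoint * displacement ξ =
      Complex.exp (symplecticProduct m ξ η * Complex.I) • displacement (ξ - η) := by
  rw [adjoint_displacement, displacement_mul, neg_add_eq_sub, map_neg, LinearMap.neg_apply,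
    ← symplecticProduct_swap]

theorem coeFn_parity (f : ModeSpace m) : parity m f =ᵐ[volume] fun x => f (-x) :=
  Lp.coeFn_compMeasurePreserving f (Measure.measurePreserving_neg volume)

theorem parity_mul_displacement (ξ : Fin m → ℂ) :
    parity m * displacement ξ = displacement (-ξ) * parity m := by
  ext1 f
  refine Lp.ext ?_
  rw [mul_apply_eq_comp, mul_apply_eq_comp]
  filter_upwards [coeFn_parity (displacement ξ f), coeFn_displacement (-ξ) (parity m f),
    (Measure.measurePreserving_neg volume).quasiMeasurePreserving.ae (coeFn_displacement ξ f),
    displaceFun_congr_ae (-ξ) (coeFn_parity f)] with x hparity hneg hξ hf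
  rw [hparity, hneg, hf, hξ]
  simp only [displaceFun]
  congr 1
  · simp
  · congr 1
    ext k
    simp
    ring

theorem displacedParity_eq (α : Fin m → ℂ) :
    displacedParity α = displacement (2 • α) * parity m := by
  rw [displacedParity, adjoint_displacement, mul_assoc, parity_mul_displacement, neg_neg,
    ← mul_assoc, displacement_mul, two_nsmul, symplecticProduct_self]
  simp

theorem norm_displacedParity_apply (α : Fin m → ℂ) (f : ModeSpace m) :
    ‖displacedParity α f‖ = ‖f‖ := by
  rw [displacedParity_eq, mul_apply_eq_comp, norm_displacement_apply]
  exact LinearIsometry.norm_map _ f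

theorem norm_displacedParity_le (α : Fin m → ℂ) : ‖displacedParity α‖ ≤ 1 :=
  ContinuousLinearMap.opNorm_le_bound _ zero_le_one fun f => by
    rw [norm_displacedParity_apply, one_mul]

theorem adjoint_parity : (parity m).adjoint = parity m := by
  have hmul : parity m * parity m = 1 := by
    ext1 f
    refine Lp.ext ?_
    filter_upwards [coeFn_parity (parity m f),
      (Measure.measurePreserving_neg volume).quasiMeasurePreserving.ae (coeFn_parity f)]
      with x hx hneg
    rw [mul_apply_eq_comp, hx, hneg, neg_neg, one_apply_eq_self]
  have hadj : (parity m).adjoint * parity m = 1 :=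
    (ContinuousLinearMap.norm_map_iff_adjoint_comp_self _).1 fun f => LinearIsometry.norm_map _ f
  exact left_inv_eq_right_inv hadj hmul

theorem adjoint_displacedParity (α : Fin m → ℂ) :
    (displacedParity α).adjoint = displacedParity α := by
  simp only [displacedParity, ← ContinuousLinearMap.star_eq_adjoint, star_mul, star_star,
    mul_assoc]
  rw [ContinuousLinearMap.star_eq_adjoint (parity m), adjoint_parity]

theorem displacement_conj_displacement (ξ η : Fin m → ℂ) :
    displacement ξ * displacement η * displacement ξ = displacement (2 • ξ + η) := by
  rw [displacement_mul, smul_mul_assoc, displacement_mul, smul_smul, ← Complex.exp_add,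
    map_add, LinearMap.add_apply, symplecticProduct_self, symplecticProduct_swap ξ η, two_nsmul,
    add_right_comm]
  simp

/-- The plane wave `exp(2i ∑ₖ Im (ξₖ αₖ*))`, the kernel of the symplectic Fourier transform that
exchanges Wigner functions and characteristic functions. -/
def planeWave (ξ α : Fin m → ℂ) : ℂ := Complex.exp ((2 * symplecticProduct m ξ α : ℝ) * Complex.I)

theorem displacement_conj_displacedParity (ξ α : Fin m → ℂ) :
    displacement ξ * displacedParity α * displacement ξ =
      planeWave (2 • ξ) α • displacedParity α := by
  have hswap : displacement ξ * displacement (2 • α) * displacement (-ξ) =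
      planeWave (2 • ξ) α • displacement (2 • α) := by
    rw [displacement_mul, smul_mul_assoc, displacement_mul, smul_smul, ← Complex.exp_add,
      planeWave]
    simp only [map_add, map_neg, map_nsmul, LinearMap.add_apply, LinearMap.smul_apply,
      symplecticProduct_self, symplecticProduct_swap ξ α, add_neg_cancel_comm]
    congr 2
    push_cast
    ring
  rw [displacedParity_eq, mul_assoc, mul_assoc, parity_mul_displacement, ← mul_assoc, ← mul_assoc,
    hswap, smul_mul_assoc]

end Displacement

/-! ### Strong continuity -/

section Continuity

variable {m : ℕ} {X : Type*} [TopologicalSpace X]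

theorem continuous_of_continuous_inner {𝕜 H : Type*} [RCLike 𝕜] [NormedAddCommGroup H]
    [InnerProductSpace 𝕜 H] {F : X → H} (hF : Continuous fun x => ‖F x‖)
    (h : ∀ y, Continuous fun x => inner 𝕜 y (F x)) : Continuous F := by
  refine continuous_iff_continuousAt.2 fun x₀ => tendsto_iff_norm_sub_tendsto_zero.2 ?_
  have hnorm (x : X) : ‖F x - F x₀‖ =
      √(‖F x‖ ^ 2 - 2 * RCLike.re (inner 𝕜 (F x₀) (F x)) + ‖F x₀‖ ^ 2) := by
    rw [inner_re_symm, ← norm_sub_sq, Real.sqrt_sq (norm_nonneg _)]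
  have hcont : Continuous fun x => ‖F x - F x₀‖ := by
    have hinner := h (F x₀)
    simp only [hnorm]
    fun_prop
  simpa using hcont.tendsto x₀

theorem continuous_apply_of_dense_span {𝕜 E F : Type*} [NontriviallyNormedField 𝕜]
    [NormedAddCommGroup E] [NormedSpace 𝕜 E] [NormedAddCommGroup F] [NormedSpace 𝕜 F] {s : Set E}
    (hs : Dense (Submodule.span 𝕜 s : Set E)) {O : X → E →L[𝕜] F} {C : ℝ} (hO : ∀ x, ‖O x‖ ≤ C)
    (h : ∀ v ∈ s, Continuous fun x => O x v) (v : E) : Continuous fun x => O x v := by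
  have hspan (w : E) (hw : w ∈ Submodule.span 𝕜 s) : Continuous fun x => O x w := by
    induction hw using Submodule.span_induction with
    | mem w hw => exact h w hw
    | zero => simpa using continuous_const
    | add w w' _ _ hw hw' => simp only [map_add]; fun_prop
    | smul c w _ hw => simp only [map_smul]; fun_prop
  refine continuous_of_uniform_approx_of_continuous fun u hu => ?_
  obtain ⟨ε, hε, hεu⟩ := Metric.mem_uniformity_dist.1 hu
  obtain ⟨w, hw, hws⟩ := Metric.dense_iff.1 hs v (ε / (|C| + 1)) (by positivity)
  refine ⟨fun x => O x w, hspan w hws, fun x => hεu ?_⟩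
  rw [Metric.mem_ball, dist_comm, dist_eq_norm, lt_div_iff₀ (by positivity), mul_comm] at hw
  rw [dist_eq_norm, ← map_sub]
  refine lt_of_le_of_lt ((O x).le_of_opNorm_le ((hO x).trans ?_) _) hw
  linarith [le_abs_self C]

theorem continuous_displacement_im (f : ModeSpace m) :
    Continuous fun y : Fin m → ℝ => displacement (fun k => (y k : ℂ) * Complex.I) f := by
  refine continuous_of_continuous_inner (𝕜 := ℂ)
    (by simpa only [norm_displacement_apply] using continuous_const) fun g => ?_
  have hinner (y : Fin m → ℝ) : inner ℂ g (displacement (fun k => (y k : ℂ) * Complex.I) f) =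
      ∫ x, Complex.exp ((∑ k, √2 * y k * x k : ℝ) * Complex.I) * inner ℂ (g x) (f x) := by
    rw [L2.inner_def]
    refine integral_congr_ae ?_
    filter_upwards [coeFn_displacement (fun k => (y k : ℂ) * Complex.I) f] with x hx
    rw [hx]
    simp [displaceFun, mul_assoc, mul_comm Complex.I]
  have hint : Integrable fun x => inner ℂ (g x) (f x) := L2.integrable_inner g f
  simp_rw [hinner]
  refine continuous_of_dominated (bound := fun x => ‖inner ℂ (g x) (f x)‖) (fun y => ?_)
    (fun y => ?_) hint.norm ?_
  · exact (Continuous.aestronglyMeasurable (by fun_prop)).mul hint.1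
  · refine Filter.Eventually.of_forall fun x => ?_
    rw [norm_mul, Complex.norm_exp_ofReal_mul_I, one_mul]
  · exact Filter.Eventually.of_forall fun x => by fun_prop

theorem continuous_displacement_re (f : ModeSpace m) :
    Continuous fun y : Fin m → ℝ => displacement (fun k => (y k : ℂ)) f := by
  have hshift : Continuous fun y : Fin m → ℝ =>
      (ContinuousMap.mk (fun p : (Fin m → ℝ) × (Fin m → ℝ) => fun k => p.2 k - √2 * p.1 k)
        (by fun_prop)).curry y :=
    ContinuousMap.continuous _
  have hcomp := (continuous_const (y := f)).compMeasurePreservingLp hshift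
    (fun y => measurePreserving_sub_right volume fun k => √2 * y k) (by simp)
  convert hcomp using 2 with y
  refine Lp.ext ?_
  filter_upwards [coeFn_displacement (fun k => (y k : ℂ)) f,
    Lp.coeFn_compMeasurePreserving f (measurePreserving_sub_right volume fun k => √2 * y k)]
    with x hdisp hshift_apply
  rw [hdisp]
  refine Eq.trans ?_ hshift_apply.symm
  simp only [displaceFun, Complex.ofReal_re, Complex.ofReal_im, mul_zero, zero_mul, sub_self,
    Finset.sum_const_zero, Complex.ofReal_zero, Complex.exp_zero, one_mul]
  rfl

theorem inner_displacement_eq (ξ : Fin m → ℂ) (g f : ModeSpace m) :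
    inner ℂ g (displacement ξ f) = Complex.exp ((-∑ k, (ξ k).im * (ξ k).re : ℝ) * Complex.I) *
      inner ℂ (displacement (fun k => ((-(ξ k).im : ℝ) : ℂ) * Complex.I) g)
        (displacement (fun k => ((ξ k).re : ℂ)) f) := by
  have hadj : displacement (fun k => ((-(ξ k).im : ℝ) : ℂ) * Complex.I) =
      (displacement fun k => ((ξ k).im : ℂ) * Complex.I).adjoint := by
    rw [adjoint_displacement]
    congr 1
    ext k
    simp
  have hsum : ((fun k => ((ξ k).im : ℂ) * Complex.I) + fun k => ((ξ k).re : ℂ)) = ξ := by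
    ext k
    rw [Pi.add_apply, add_comm, Complex.re_add_im]
  rw [hadj, ContinuousLinearMap.adjoint_inner_left, ← mul_apply_eq_comp, displacement_mul, hsum,
    smul_apply, inner_smul_right, ← mul_assoc, ← Complex.exp_add]
  simp [symplecticProduct_apply]

theorem continuous_displacement (f : ModeSpace m) :
    Continuous fun ξ : Fin m → ℂ => displacement ξ f := by
  refine continuous_of_continuous_inner (𝕜 := ℂ)
    (by simpa only [norm_displacement_apply] using continuous_const) fun g => ?_
  rw [funext fun ξ => inner_displacement_eq ξ g f]
  refine Continuous.mul (by fun_prop) (Continuous.inner ?_ ?_)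
  · exact (continuous_displacement_im g).comp
      (by fun_prop : Continuous fun (ξ : Fin m → ℂ) k => -(ξ k).im)
  · exact (continuous_displacement_re f).comp
      (by fun_prop : Continuous fun (ξ : Fin m → ℂ) k => (ξ k).re)

theorem continuous_displacedParity (f : ModeSpace m) :
    Continuous fun α : Fin m → ℂ => displacedParity α f := by
  simp_rw [displacedParity_eq]
  exact (continuous_displacement (parity m f)).comp (continuous_const_smul 2)

theorem continuous_tensorOp_apply {O O' : X → ModeSpace m →L[ℂ] ModeSpace m}
    (hO : ∀ x, ‖O x‖ ≤ 1) (hO' : ∀ x, ‖O' x‖ ≤ 1) (h : ∀ f, Continuous fun x => O x f)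
    (h' : ∀ f, Continuous fun x => O' x f) (v : Bipartite m) :
    Continuous fun x => tensorOp (O x) (O' x) v := by
  refine continuous_apply_of_dense_span dense_span_productVector (C := 1) (fun x => ?_) ?_ v
  · exact (norm_tensorOp_le _ _).trans (mul_le_one₀ (hO x) (norm_nonneg _) (hO' x))
  · rintro _ ⟨f, g, rfl⟩
    simp_rw [tensorOp_productVector, ← productVectorL_apply]
    exact ((productVectorL m).continuous.comp (h f)).clm_apply (h' g)

end Continuity

section Joint

variable {m : ℕ}

/-- The phase space of the `2m` modes, with points `(α_A, α_B)`. -/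
abbrev PhaseSpace (m : ℕ) : Type := (Fin m → ℂ) × (Fin m → ℂ)

/-- The displacement operator of all `2m` modes. -/
def jointDisplacement (ξ : PhaseSpace m) : Bipartite m →L[ℂ] Bipartite m :=
  tensorOp (displacement ξ.1) (displacement ξ.2)

/-- The displaced parity operator of all `2m` modes. -/
def jointDisplacedParity (α : PhaseSpace m) : Bipartite m →L[ℂ] Bipartite m :=
  tensorOp (displacedParity α.1) (displacedParity α.2)

theorem displacementA_mul_displacementB (ξ η : Fin m → ℂ) :
    displacementA ξ * displacementB η = jointDisplacement (ξ, η) := by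
  rw [displacementA, displacementB, tensorOp_mul, mul_one, one_mul, jointDisplacement]

theorem norm_jointDisplacement_le (ξ : PhaseSpace m) : ‖jointDisplacement ξ‖ ≤ 1 :=
  (norm_tensorOp_le _ _).trans
    (mul_le_one₀ (norm_displacement_le _) (norm_nonneg _) (norm_displacement_le _))

theorem norm_jointDisplacedParity_le (α : PhaseSpace m) : ‖jointDisplacedParity α‖ ≤ 1 :=
  (norm_tensorOp_le _ _).trans
    (mul_le_one₀ (norm_displacedParity_le _) (norm_nonneg _) (norm_displacedParity_le _))

theorem continuous_jointDisplacement (x : Bipartite m) :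
    Continuous fun ξ : PhaseSpace m => jointDisplacement ξ x :=
  continuous_tensorOp_apply (fun _ => norm_displacement_le _) (fun _ => norm_displacement_le _)
    (fun f => (continuous_displacement f).comp continuous_fst)
    (fun f => (continuous_displacement f).comp continuous_snd) x

theorem continuous_jointDisplacedParity (x : Bipartite m) :
    Continuous fun α : PhaseSpace m => jointDisplacedParity α x :=
  continuous_tensorOp_apply (fun _ => norm_displacedParity_le _)
    (fun _ => norm_displacedParity_le _)
    (fun f => (continuous_displacedParity f).comp continuous_fst)
    (fun f => (continuous_displacedParity f).comp continuous_snd) x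

theorem adjoint_jointDisplacement (ξ : PhaseSpace m) :
    (jointDisplacement ξ).adjoint = jointDisplacement (-ξ) := by
  rw [jointDisplacement, adjoint_tensorOp, adjoint_displacement, adjoint_displacement]
  rfl

theorem adjoint_jointDisplacedParity (α : PhaseSpace m) :
    (jointDisplacedParity α).adjoint = jointDisplacedParity α := by
  rw [jointDisplacedParity, adjoint_tensorOp, adjoint_displacedParity, adjoint_displacedParity]

/-- The Weyl phases of the two parties cancel. -/
theorem jointDisplacement_sub_eq_mul_adjoint {ξ η : PhaseSpace m}
    (h : symplecticProduct m ξ.1 η.1 = symplecticProduct m ξ.2 η.2) :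
    jointDisplacement (ξ - η) =
      tensorOp (displacement ξ.1) (displacement η.2).adjoint *
        (tensorOp (displacement η.1) (displacement ξ.2).adjoint).adjoint := by
  rw [adjoint_tensorOp, ContinuousLinearMap.adjoint_adjoint, tensorOp_mul,
    displacement_mul_adjoint, adjoint_mul_displacement, tensorOp_smul_smul, ← Complex.exp_add, h,
    neg_mul, neg_add_cancel, Complex.exp_zero, one_smul]
  rfl

end Joint

/-! ### Gaussian averages of displacements -/

section Gaussian

open scoped Real

variable {m : ℕ}

variable (m) in
/-- The splitting of `α ∈ ℂᵐ` into its real and imaginary parts. -/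
def complexPiEquiv : (Fin m → ℂ) ≃ᵐ (Fin m → ℝ) × (Fin m → ℝ) :=
  (MeasurableEquiv.piCongrRight fun _ => Complex.measurableEquivRealProd).trans
    (MeasurableEquiv.arrowProdEquivProdArrow ℝ ℝ (Fin m))

theorem measurePreserving_complexPiEquiv : MeasurePreserving (complexPiEquiv m) :=
  (volume_measurePreserving_arrowProdEquivProdArrow ℝ ℝ (Fin m)).comp
    (volume_preserving_pi fun _ => Complex.volume_preserving_equiv_real_prod)

theorem complexPiEquiv_symm_apply (p : (Fin m → ℝ) × (Fin m → ℝ)) :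
    (complexPiEquiv m).symm p = fun k => ⟨p.1 k, p.2 k⟩ :=
  (complexPiEquiv m).symm_apply_eq.2 rfl

theorem integral_complexPi {E : Type*} [NormedAddCommGroup E] [NormedSpace ℝ E]
    {F : (Fin m → ℂ) → E} (hF : Integrable F) :
    ∫ α, F α = ∫ a : Fin m → ℝ, ∫ b : Fin m → ℝ, F fun k => ⟨a k, b k⟩ := by
  have hsymm := measurePreserving_complexPiEquiv (m := m).symm
  rw [← hsymm.integral_comp', Measure.volume_eq_prod, integral_prod]
  · simp only [complexPiEquiv_symm_apply]
  · exact hsymm.integrable_comp_of_integrable hF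

/-- The Gaussian `exp(-s ∑ₖ |αₖ|²)` on phase space. -/
def gaussian (s : ℝ) (α : Fin m → ℂ) : ℝ := Real.exp (-s * ∑ k, ‖α k‖ ^ 2)

theorem gaussian_nonneg (s : ℝ) (α : Fin m → ℂ) : 0 ≤ gaussian s α := (Real.exp_pos _).le

theorem gaussian_le_one {s : ℝ} (hs : 0 ≤ s) (α : Fin m → ℂ) : gaussian s α ≤ 1 := by
  rw [gaussian, Real.exp_le_one_iff, neg_mul, neg_nonpos]
  positivity

theorem integral_gaussian {s : ℝ} (hs : 0 < s) :
    ∫ α : Fin m → ℂ, gaussian s α = (π / s) ^ m := by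
  have hprod (α : Fin m → ℂ) : gaussian s α = ∏ k, Real.exp (-s * ‖α k‖ ^ 2) := by
    rw [gaussian, Finset.mul_sum, Real.exp_sum]
  simp_rw [hprod]
  rw [integral_fintype_prod_volume_eq_prod (fun _ (z : ℂ) => Real.exp (-s * ‖z‖ ^ 2)),
    GaussianFourier.integral_rexp_neg_mul_sq_norm hs]
  simp [div_pow]

theorem integrable_gaussian {s : ℝ} (hs : 0 < s) : Integrable (gaussian (m := m) s) :=
  .of_integral_ne_zero (by rw [integral_gaussian hs]; positivity)

theorem measurePreserving_shear (c : ℝ) : MeasurePreserving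
    fun p : (Fin m → ℂ) × (Fin m → ℝ) => (p.1, fun k => p.2 k - √2 * ((c • p.1) k).re) :=
  (MeasurePreserving.id volume).skew_product (by fun_prop)
    (.of_forall fun α => (measurePreserving_shift (c • α)).map_eq)

theorem integrable_gaussian_mul_displaceFun {s : ℝ} (hs : 0 < s) (c : ℝ)
    {f g : (Fin m → ℝ) → ℂ} (hf : MemLp f 2) (hg : MemLp g 2) :
    Integrable (fun p : (Fin m → ℂ) × (Fin m → ℝ) =>
      gaussian s p.1 * (starRingEnd ℂ (f p.2) * displaceFun (c • p.1) g p.2)) := by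
  have hf_int : Integrable fun p : (Fin m → ℂ) × (Fin m → ℝ) => gaussian s p.1 * ‖f p.2‖ ^ 2 :=
    (integrable_gaussian hs).mul_prod (hf.integrable_norm_pow two_ne_zero)
  have hg_int : Integrable fun p : (Fin m → ℂ) × (Fin m → ℝ) => gaussian s p.1 *
      ‖g fun k => p.2 k - √2 * ((c • p.1) k).re‖ ^ 2 :=
    (measurePreserving_shear c).integrable_comp_of_integrable
      ((integrable_gaussian hs).mul_prod (hg.integrable_norm_pow two_ne_zero))
  refine (hf_int.add hg_int).mono' ?_ (.of_forall fun p => ?_)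
  · have hf_meas : AEStronglyMeasurable fun p : (Fin m → ℂ) × (Fin m → ℝ) =>
        starRingEnd ℂ (f p.2) :=
      Complex.continuous_conj.comp_aestronglyMeasurable hf.1.comp_snd
    have hg_meas : AEStronglyMeasurable fun p : (Fin m → ℂ) × (Fin m → ℝ) =>
        g fun k => p.2 k - √2 * ((c • p.1) k).re :=
      hg.1.comp_snd.comp_measurePreserving (measurePreserving_shear c)
    unfold gaussian displaceFun
    exact .mul (Continuous.aestronglyMeasurable (by fun_prop))
      (hf_meas.mul (.mul (Continuous.aestronglyMeasurable (by fun_prop)) hg_meas))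
  · rw [norm_mul, norm_mul, norm_displaceFun, RCLike.norm_conj, Complex.norm_real,
      Real.norm_of_nonneg (gaussian_nonneg _ _), Pi.add_apply, ← mul_add]
    refine mul_le_mul_of_nonneg_left ?_ (gaussian_nonneg _ _)
    nlinarith [sq_nonneg (‖f p.2‖ - ‖g fun k => p.2 k - √2 * ((c • p.1) k).re‖),
      norm_nonneg (f p.2), norm_nonneg (g fun k => p.2 k - √2 * ((c • p.1) k).re)]

/-- The kernel of the Gaussian average of the displacements `D(cα)`, where `a` is the real part
of `α` and its imaginary part has been integrated out. -/
def gaussianKernel (s c : ℝ) (x a : Fin m → ℝ) : ℝ :=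
  √(π / s) ^ m * Real.exp (-∑ k, (s * a k ^ 2 + (c * (√2 * x k - c * a k)) ^ 2 / (4 * s)))

theorem integral_cexp_neg_mul_sum_sq_add_I {s : ℝ} (hs : 0 < s) (y : Fin m → ℝ) :
    ∫ b : Fin m → ℝ, Complex.exp (-s * ∑ k, (b k : ℂ) ^ 2 + ∑ k, Complex.I * y k * b k) =
      (√(π / s) ^ m * Real.exp (-∑ k, y k ^ 2 / (4 * s)) : ℝ) := by
  have hpow : (π / s : ℂ) ^ ((m : ℂ) / 2) = ((√(π / s) ^ m : ℝ) : ℂ) := by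
    have hhalf : (m : ℂ) / 2 = (((1 / 2 : ℝ) * m : ℝ) : ℂ) := by push_cast; ring
    rw [hhalf, ← Complex.ofReal_div, ← Complex.ofReal_cpow (by positivity),
      Real.rpow_mul (by positivity), Real.rpow_natCast, Real.sqrt_eq_rpow]
  rw [GaussianFourier.integral_cexp_neg_mul_sum_add (by simpa using hs), Fintype.card_fin, hpow]
  simp only [mul_pow, Complex.I_sq, ← Finset.mul_sum]
  push_cast
  simp only [neg_mul, one_mul, neg_div, ← Finset.sum_div]

theorem integral_gaussian_mul_displaceFun_im {s : ℝ} (hs : 0 < s) (c : ℝ)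
    (g : (Fin m → ℝ) → ℂ) (x a : Fin m → ℝ) :
    ∫ b : Fin m → ℝ, gaussian s (fun k => ⟨a k, b k⟩) *
        displaceFun (c • fun k => (⟨a k, b k⟩ : ℂ)) g x =
      gaussianKernel s c x a * g (fun k => x k - √2 * (c * a k)) := by
  have hexp (b : Fin m → ℝ) : gaussian s (fun k => ⟨a k, b k⟩) *
        displaceFun (c • fun k => (⟨a k, b k⟩ : ℂ)) g x =
      Real.exp (-s * ∑ k, a k ^ 2) * g (fun k => x k - √2 * (c * a k)) *
      Complex.exp (-s * ∑ k, (b k : ℂ) ^ 2 +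
        ∑ k, Complex.I * ((c * (√2 * x k - c * a k) : ℝ) : ℂ) * b k) := by
    have hsq (k : Fin m) : ‖(⟨a k, b k⟩ : ℂ)‖ ^ 2 = a k ^ 2 + b k ^ 2 := by
      rw [← Complex.normSq_eq_norm_sq, Complex.normSq_mk, sq, sq]
    simp only [gaussian, displaceFun, hsq, Finset.sum_add_distrib, mul_add, Real.exp_add,
      Complex.exp_add, Pi.smul_apply, Complex.real_smul, Complex.re_ofReal_mul,
      Complex.im_ofReal_mul]
    push_cast
    rw [mul_comm _ (g _), mul_comm _ (g _), mul_left_comm, mul_assoc (g _),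
      ← mul_assoc (Complex.exp _)]
    congr 4
    rw [Finset.mul_sum]
    exact Finset.sum_congr rfl fun k _ => by ring
  simp_rw [hexp]
  rw [integral_const_mul, integral_cexp_neg_mul_sum_sq_add_I hs, mul_right_comm,
    ← Complex.ofReal_mul, mul_left_comm, ← Real.exp_add, gaussianKernel, Finset.mul_sum,
    ← Finset.sum_neg_distrib, ← Finset.sum_neg_distrib, ← Finset.sum_add_distrib]
  congr 6
  funext k
  ring

theorem integral_gaussian_mul_integral_displaceFun {s : ℝ} (hs : 0 < s) (c : ℝ)
    {f g : (Fin m → ℝ) → ℂ} (hf : MemLp f 2) (hg : MemLp g 2) :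
    ∫ α : Fin m → ℂ, gaussian s α * ∫ x, starRingEnd ℂ (f x) * displaceFun (c • α) g x =
      ∫ x, starRingEnd ℂ (f x) * ∫ a : Fin m → ℝ,
        gaussianKernel s c x a * g (fun k => x k - √2 * (c * a k)) := by
  have hint := integrable_gaussian_mul_displaceFun hs c hf hg
  simp_rw [← integral_const_mul]
  rw [integral_integral_swap hint]
  refine integral_congr_ae ?_
  filter_upwards [hint.prod_left_ae] with x hx
  rw [integral_complexPi hx, integral_const_mul]
  simp_rw [← integral_gaussian_mul_displaceFun_im hs, mul_left_comm _ (starRingEnd ℂ (f x)),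
    integral_const_mul]

end Gaussian

/-! ### Smeared operators -/

section Smear

variable {H X Y ι : Type*} [NormedAddCommGroup H] [InnerProductSpace ℂ H] [CompleteSpace H]
  [MeasurableSpace X] {μ : Measure X} [MeasurableSpace Y] {ν : Measure Y}

theorem exists_inner_eq_integral {w : X → ℂ} (hw : Integrable w μ) {O : X → H →L[ℂ] H}
    (hO : ∀ x, ‖O x‖ ≤ 1) (hm : ∀ v, AEStronglyMeasurable (fun x => O x v) μ) :
    ∃ S : H →L[ℂ] H, ∀ u v, inner ℂ u (S v) = ∫ x, w x * inner ℂ u (O x v) ∂μ := by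
  have hle (x : X) (v : H) : ‖w x • O x v‖ ≤ ‖w x‖ * ‖v‖ := by
    rw [norm_smul]
    gcongr
    simpa using (O x).le_of_opNorm_le (hO x) v
  have hint (v : H) : Integrable (fun x => w x • O x v) μ :=
    (hw.norm.mul_const ‖v‖).mono' (hw.1.smul (hm v)) (.of_forall fun x => hle x v)
  refine ⟨LinearMap.mkContinuous
    { toFun := fun v => ∫ x, w x • O x v ∂μ
      map_add' := fun u v => by
        simp only [map_add, smul_add]
        exact integral_add (hint u) (hint v)
      map_smul' := fun c v => by
        simp only [map_smul, smul_comm (w _) c, RingHom.id_apply]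
        exact integral_smul c _ } (∫ x, ‖w x‖ ∂μ) fun v => ?_, fun u v => ?_⟩
  · rw [← integral_mul_const]
    exact norm_integral_le_of_norm_le (hw.norm.mul_const _) (.of_forall fun x => hle x v)
  · change inner ℂ u (∫ x, w x • O x v ∂μ) = _
    rw [← integral_inner (hint v)]
    simp only [inner_smul_right]

theorem integral_tsum_of_norm_le {F : ι → X → ℂ} {b : ι → ℝ} {g : X → ℝ} (hb : Summable b)
    (hg : Integrable g μ) (hF : ∀ i, AEStronglyMeasurable (F i) μ)
    (h : ∀ i x, ‖F i x‖ ≤ b i * g x) : ∫ x, ∑' i, F i x ∂μ = ∑' i, ∫ x, F i x ∂μ := by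
  -- `ι` may be uncountable, but `F i = 0` for all but countably many `i`
  have : Countable (Function.support b) := hb.countable_support.to_subtype
  have hzero (i : ι) (hi : i ∉ Function.support b) (x : X) : F i x = 0 := by
    simpa [Function.notMem_support.1 hi] using h i x
  have hF_int (i : ι) : Integrable (F i) μ :=
    (hg.const_mul (b i)).mono' (hF i) (.of_forall (h i))
  have hsum (x : X) : ∑' i, F i x = ∑' i : Function.support b, F i x :=
    (tsum_subtype_eq_of_support_subset fun i => not_imp_not.1 fun hi => by
      simpa using hzero i hi x).symm
  have hsum_integral : ∑' i, ∫ x, F i x ∂μ = ∑' i : Function.support b, ∫ x, F i x ∂μ :=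
    (tsum_subtype_eq_of_support_subset fun i => not_imp_not.1 fun hi => by
      simp [hzero i hi]).symm
  simp_rw [hsum, hsum_integral]
  refine (hasSum_integral_of_summable_integral_norm
    (F := fun i : Function.support b => F i) (fun i => hF_int i) ?_).tsum_eq.symm
  refine .of_nonneg_of_le (fun i => integral_nonneg fun _ => norm_nonneg _) (fun i => ?_)
    ((hb.subtype (Function.support b)).mul_right (∫ x, g x ∂μ))
  rw [Function.comp_apply, ← integral_const_mul]
  exact integral_mono (hF_int i).norm (hg.const_mul (b i)) (h i)

namespace IsPositiveTraceClass

variable {P : H →L[ℂ] H}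

theorem norm_inner_sqrtVec_le {A : H →L[ℂ] H} (hA : ‖A‖ ≤ 1) (n : basisIndex H) :
    ‖inner ℂ (sqrtVec P n) (A (sqrtVec P n))‖ ≤ ‖sqrtVec P n‖ ^ 2 := by
  refine (norm_inner_le_norm _ _).trans ?_
  rw [sq]
  gcongr
  simpa using A.le_of_opNorm_le hA (sqrtVec P n)

theorem opTrace_mul_eq_integral (hP : IsPositiveTraceClass P) {w : X → ℂ} (hw : Integrable w μ)
    {O : X → H →L[ℂ] H} (hO : ∀ x, ‖O x‖ ≤ 1)
    (hm : ∀ v, AEStronglyMeasurable (fun x => O x v) μ) {S : H →L[ℂ] H}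
    (hS : ∀ u v, inner ℂ u (S v) = ∫ x, w x * inner ℂ u (O x v) ∂μ) :
    opTrace (P * S) = ∫ x, w x * opTrace (P * O x) ∂μ := by
  simp_rw [hP.opTrace_mul, hS, ← tsum_mul_left]
  refine (integral_tsum_of_norm_le hP.hasSum_sq_norm_sqrtVec.summable hw.norm (fun n => ?_)
    fun n x => ?_).symm
  · exact hw.1.mul (aestronglyMeasurable_const.inner (hm _))
  · rw [norm_mul, mul_comm]
    gcongr
    exact norm_inner_sqrtVec_le (hO x) n

theorem integral_mul_opTrace_congr (hP : IsPositiveTraceClass P) {s : Set H}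
    (hs : Dense (Submodule.span ℂ s : Set H)) {w : X → ℂ} (hw : Integrable w μ)
    {O : X → H →L[ℂ] H} (hO : ∀ x, ‖O x‖ ≤ 1)
    (hm : ∀ v, AEStronglyMeasurable (fun x => O x v) μ) {w' : Y → ℂ} (hw' : Integrable w' ν)
    {O' : Y → H →L[ℂ] H} (hO' : ∀ y, ‖O' y‖ ≤ 1)
    (hm' : ∀ v, AEStronglyMeasurable (fun y => O' y v) ν)
    (h : ∀ u ∈ s, ∀ v ∈ s,
      ∫ x, w x * inner ℂ u (O x v) ∂μ = ∫ y, w' y * inner ℂ u (O' y v) ∂ν) :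
    ∫ x, w x * opTrace (P * O x) ∂μ = ∫ y, w' y * opTrace (P * O' y) ∂ν := by
  obtain ⟨S, hS⟩ := exists_inner_eq_integral hw hO hm
  obtain ⟨S', hS'⟩ := exists_inner_eq_integral hw' hO' hm'
  have hSS' : S = S' := ContinuousLinearMap.ext_on hs fun v hv =>
    hs.eq_of_inner_right ℂ fun u hu => by
      induction hu using Submodule.span_induction with
      | mem u hu => rw [hS, hS', h u hu v hv]
      | zero => rw [inner_zero_left, inner_zero_left]
      | add u u' _ _ hu hu' => rw [inner_add_left, inner_add_left, hu, hu']
      | smul c u _ hu => rw [inner_smul_left, inner_smul_left, hu]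
  rw [← hP.opTrace_mul_eq_integral hw hO hm hS, hSS',
    ← hP.opTrace_mul_eq_integral hw' hO' hm' hS']

theorem continuous_opTrace_mul {Z : Type*} [TopologicalSpace Z] (hP : IsPositiveTraceClass P)
    {O : Z → H →L[ℂ] H} (hO : ∀ z, ‖O z‖ ≤ 1) (hc : ∀ v, Continuous fun z => O z v) :
    Continuous fun z => opTrace (P * O z) := by
  simp_rw [hP.opTrace_mul]
  exact continuous_tsum (fun n => continuous_const.inner (hc _)) hP.hasSum_sq_norm_sqrtVec.summable
    fun n z => norm_inner_sqrtVec_le (hO z) n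

end IsPositiveTraceClass

end Smear

/-! ### The characteristic function as the Fourier transform of the Wigner function -/

section Wigner

open scoped Real

variable {m : ℕ}

theorem inner_displacement (ξ : Fin m → ℂ) (f g : ModeSpace m) :
    inner ℂ f (displacement ξ g) = ∫ x, starRingEnd ℂ (f x) * displaceFun ξ g x := by
  rw [L2.inner_def]
  refine integral_congr_ae ?_
  filter_upwards [coeFn_displacement ξ g] with x hx
  rw [hx, RCLike.inner_apply, mul_comm]

theorem inner_displacedParity (α : Fin m → ℂ) (f g : ModeSpace m) :
    inner ℂ f (displacedParity α g) =
      ∫ x, starRingEnd ℂ (f x) * displaceFun ((2 : ℝ) • α) (fun x => g (-x)) x := by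
  rw [displacedParity_eq, mul_apply_eq_comp, inner_displacement, two_nsmul, ← two_smul ℝ]
  refine integral_congr_ae ?_
  filter_upwards [displaceFun_congr_ae ((2 : ℝ) • α) (coeFn_parity g)] with x hx
  rw [hx]

theorem gaussianKernel_substitution {t : ℝ} (ht : 0 < t) (x p : Fin m → ℝ) :
    (2 / π) ^ m * ((t / 2) ^ m *
        gaussianKernel (t ^ 2) 2 x ((fun k => √2 * x k / 2) - (t / 2) • p)) =
      (1 / π) ^ m * gaussianKernel 1 t x p := by
  rw [gaussianKernel, gaussianKernel, ← mul_assoc, ← mul_assoc, ← mul_assoc]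
  congr 1
  · rw [Real.sqrt_div Real.pi_pos.le, Real.sqrt_sq ht.le, div_one, ← mul_pow, ← mul_pow,
      ← mul_pow]
    congr 1
    field_simp
  · congr 2
    refine Finset.sum_congr rfl fun k _ => ?_
    rw [Pi.sub_apply, Pi.smul_apply, smul_eq_mul]
    field_simp
    ring

theorem integral_comp_sub_smul {E F : Type*} [NormedAddCommGroup E] [NormedSpace ℝ E]
    [MeasurableSpace E] [BorelSpace E] [FiniteDimensional ℝ E] (μ : Measure E)
    [μ.IsAddHaarMeasure] [NormedAddCommGroup F] [NormedSpace ℝ F] (h : E → F) (v : E) {r : ℝ}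
    (hr : r ≠ 0) :
    ∫ a, h a ∂μ = |r| ^ Module.finrank ℝ E • ∫ p, h (v - r • p) ∂μ := by
  rw [Measure.integral_comp_smul μ (fun q => h (v - q)) r, integral_sub_left_eq_self h μ v,
    smul_smul, abs_inv, abs_pow, mul_inv_cancel₀ (pow_ne_zero _ (abs_ne_zero.2 hr)), one_smul]

theorem integral_gaussian_mul_inner_displacedParity {t : ℝ} (ht : 0 < t) (f g : ModeSpace m) :
    (2 / π : ℝ) ^ m * ∫ α, gaussian (t ^ 2) α * inner ℂ f (displacedParity α g) =
      (1 / π : ℝ) ^ m * ∫ z, gaussian 1 z * inner ℂ f (displacement (t • z) g) := by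
  have hg_neg : MemLp (fun x => g (-x)) 2 :=
    (Lp.memLp g).comp_measurePreserving (Measure.measurePreserving_neg volume)
  simp_rw [inner_displacement, inner_displacedParity]
  rw [integral_gaussian_mul_integral_displaceFun (by positivity) 2 (Lp.memLp f) hg_neg,
    integral_gaussian_mul_integral_displaceFun one_pos t (Lp.memLp f) (Lp.memLp g),
    ← integral_const_mul, ← integral_const_mul]
  congr 1 with x
  rw [mul_left_comm, mul_left_comm _ (starRingEnd ℂ (f x))]
  congr 1
  rw [integral_comp_sub_smul volume _ (fun k => √2 * x k / 2) (by positivity : t / 2 ≠ 0),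
    ← integral_smul, ← integral_const_mul, ← integral_const_mul]
  congr 1 with p
  have harg : (-fun k => x k - √2 * (2 * ((fun k => √2 * x k / 2) - (t / 2) • p) k)) =
      fun k => x k - √2 * (t * p k) := by
    ext k
    rw [Pi.neg_apply, Pi.sub_apply, Pi.smul_apply, smul_eq_mul]
    linear_combination x k * Real.mul_self_sqrt (zero_le_two (α := ℝ))
  have hkernel := congrArg Complex.ofReal (gaussianKernel_substitution ht x p)
  push_cast at hkernel
  rw [Module.finrank_fin_fun, abs_of_pos (by positivity), Complex.real_smul, harg]
  push_cast
  rw [← mul_assoc (_ ^ m) (Complex.ofReal _), ← mul_assoc, hkernel, mul_assoc]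

theorem integral_gaussian_mul_planeWave_mul_inner_displacedParity {t : ℝ} (ht : 0 < t)
    (ξ : Fin m → ℂ) (f g : ModeSpace m) :
    (2 / π : ℝ) ^ m * ∫ α, gaussian (t ^ 2) α * planeWave ξ α * inner ℂ f (displacedParity α g) =
      (1 / π : ℝ) ^ m * ∫ z, gaussian 1 z * inner ℂ f (displacement (ξ + t • z) g) := by
  -- conjugation by `D(ξ/2)` reduces the identity to `ξ = 0`
  set η : Fin m → ℂ := (2⁻¹ : ℝ) • ξ with hη
  have hξ : 2 • η = ξ := by rw [two_nsmul, hη, ← add_smul]; norm_num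
  have hconj (A : ModeSpace m →L[ℂ] ModeSpace m) :
      inner ℂ f ((displacement η * A * displacement η) g) =
        inner ℂ ((displacement η).adjoint f) (A (displacement η g)) := by
    rw [ContinuousLinearMap.adjoint_inner_left]
    rfl
  have h := integral_gaussian_mul_inner_displacedParity ht ((displacement η).adjoint f)
    (displacement η g)
  simp_rw [← hconj, displacement_conj_displacement, displacement_conj_displacedParity, hξ] at h
  rw [← h]
  simp_rw [smul_apply, inner_smul_right, mul_assoc]

/-- The Gaussian on the phase space of all `2m` modes. -/
def jointGaussian (s : ℝ) (p : PhaseSpace m) : ℝ := gaussian s p.1 * gaussian s p.2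

/-- The plane wave on the phase space of all `2m` modes. -/
def jointPlaneWave (ξ p : PhaseSpace m) : ℂ := planeWave ξ.1 p.1 * planeWave ξ.2 p.2

/-- The characteristic function `ξ ↦ tr[P D(ξ)]` of the `2m` modes. -/
def charFun (P : Bipartite m →L[ℂ] Bipartite m) (ξ : PhaseSpace m) : ℂ :=
  opTrace (P * jointDisplacement ξ)

theorem jointGaussian_nonneg (s : ℝ) (p : PhaseSpace m) : 0 ≤ jointGaussian s p :=
  mul_nonneg (gaussian_nonneg _ _) (gaussian_nonneg _ _)

theorem jointGaussian_le_one {s : ℝ} (hs : 0 ≤ s) (p : PhaseSpace m) : jointGaussian s p ≤ 1 :=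
  mul_le_one₀ (gaussian_le_one hs _) (gaussian_nonneg _ _) (gaussian_le_one hs _)

theorem integrable_jointGaussian {s : ℝ} (hs : 0 < s) : Integrable (jointGaussian (m := m) s) :=
  (integrable_gaussian hs).mul_prod (integrable_gaussian hs)

theorem integral_jointGaussian {s : ℝ} (hs : 0 < s) :
    ∫ p : PhaseSpace m, jointGaussian s p = (π / s) ^ (2 * m) := by
  simp only [jointGaussian]
  rw [Measure.volume_eq_prod, integral_prod_mul, integral_gaussian hs, ← pow_add, two_mul]

theorem continuous_jointPlaneWave (ξ : PhaseSpace m) : Continuous (jointPlaneWave ξ) := by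
  have hcont (η : Fin m → ℂ) : Continuous (planeWave η) := by
    have := (symplecticProduct m η).continuous_of_finiteDimensional
    unfold planeWave
    fun_prop
  exact ((hcont ξ.1).comp continuous_fst).mul ((hcont ξ.2).comp continuous_snd)

theorem norm_jointPlaneWave (ξ p : PhaseSpace m) : ‖jointPlaneWave ξ p‖ = 1 := by
  rw [jointPlaneWave, planeWave, planeWave, norm_mul, Complex.norm_exp_ofReal_mul_I,
    Complex.norm_exp_ofReal_mul_I, one_mul]

variable {P : Bipartite m →L[ℂ] Bipartite m}

theorem integrable_jointGaussian_mul_jointPlaneWave {s : ℝ} (hs : 0 < s) (ξ : PhaseSpace m) :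
    Integrable fun p => jointGaussian s p * jointPlaneWave ξ p :=
  (integrable_jointGaussian hs).ofReal.mul_bdd (c := 1)
    (continuous_jointPlaneWave ξ).aestronglyMeasurable
    (.of_forall fun p => (norm_jointPlaneWave ξ p).le)

theorem integral_jointGaussian_mul_inner_productVector {t : ℝ} (ht : 0 < t) (ξ : PhaseSpace m)
    (f' g' f g : ModeSpace m) :
    ∫ p, (2 / π : ℝ) ^ (2 * m) * (jointGaussian (t ^ 2) p * jointPlaneWave ξ p) *
        inner ℂ (productVector f' g') (jointDisplacedParity p (productVector f g)) =
      ∫ q, (1 / π : ℝ) ^ (2 * m) * jointGaussian 1 q *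
        inner ℂ (productVector f' g') (jointDisplacement (ξ + t • q) (productVector f g)) := by
  let u (η : Fin m → ℂ) (h' h : ModeSpace m) (α : Fin m → ℂ) : ℂ :=
    (2 / π : ℝ) ^ m * (gaussian (t ^ 2) α * planeWave η α * inner ℂ h' (displacedParity α h))
  let v (η : Fin m → ℂ) (h' h : ModeSpace m) (z : Fin m → ℂ) : ℂ :=
    (1 / π : ℝ) ^ m * (gaussian 1 z * inner ℂ h' (displacement (η + t • z) h))
  have huv (η : Fin m → ℂ) (h' h : ModeSpace m) : ∫ α, u η h' h α = ∫ z, v η h' h z := by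
    simp only [u, v, integral_const_mul]
    exact integral_gaussian_mul_planeWave_mul_inner_displacedParity ht η h' h
  have hu (p : PhaseSpace m) : (2 / π : ℝ) ^ (2 * m) *
      (jointGaussian (t ^ 2) p * jointPlaneWave ξ p) *
        inner ℂ (productVector f' g') (jointDisplacedParity p (productVector f g)) =
      u ξ.1 f' f p.1 * u ξ.2 g' g p.2 := by
    rw [jointDisplacedParity, tensorOp_productVector, inner_productVector, jointGaussian,
      jointPlaneWave, Complex.ofReal_mul]
    ring
  have hv (q : PhaseSpace m) : (1 / π : ℝ) ^ (2 * m) * jointGaussian 1 q *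
        inner ℂ (productVector f' g') (jointDisplacement (ξ + t • q) (productVector f g)) =
      v ξ.1 f' f q.1 * v ξ.2 g' g q.2 := by
    rw [jointDisplacement, tensorOp_productVector, inner_productVector, jointGaussian,
      Complex.ofReal_mul, Prod.fst_add, Prod.snd_add, Prod.smul_fst, Prod.smul_snd]
    ring
  simp_rw [hu, hv]
  rw [Measure.volume_eq_prod, integral_prod_mul, integral_prod_mul, huv, huv]

namespace IsPositiveTraceClass

theorem continuous_charFun (hP : IsPositiveTraceClass P) : Continuous (charFun P) :=
  hP.continuous_opTrace_mul norm_jointDisplacement_le continuous_jointDisplacement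

theorem ofReal_wigner (hP : IsPositiveTraceClass P) (α : PhaseSpace m) :
    (wigner P α : ℂ) = (2 / π : ℝ) ^ (2 * m) * opTrace (P * jointDisplacedParity α) := by
  have hreal : ((opTrace (P * jointDisplacedParity α)).re : ℂ) =
      opTrace (P * jointDisplacedParity α) := by
    rw [← Complex.conj_eq_iff_re, ← hP.opTrace_mul_adjoint, adjoint_jointDisplacedParity]
  rw [← hreal]
  push_cast [wigner]
  rfl

theorem integral_jointGaussian_mul_opTrace (hP : IsPositiveTraceClass P) {t : ℝ} (ht : 0 < t)
    (ξ : PhaseSpace m) :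
    ∫ p, (2 / π : ℝ) ^ (2 * m) * (jointGaussian (t ^ 2) p * jointPlaneWave ξ p) *
        opTrace (P * jointDisplacedParity p) =
      ∫ q, (1 / π : ℝ) ^ (2 * m) * jointGaussian 1 q * charFun P (ξ + t • q) := by
  refine hP.integral_mul_opTrace_congr dense_span_productVector
    ((integrable_jointGaussian_mul_jointPlaneWave (by positivity) ξ).const_mul _)
    norm_jointDisplacedParity_le
    (fun v => (continuous_jointDisplacedParity v).aestronglyMeasurable)
    ((integrable_jointGaussian one_pos).ofReal.const_mul _)
    (fun q => norm_jointDisplacement_le _)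
    (fun v => ((continuous_jointDisplacement v).comp (by fun_prop)).aestronglyMeasurable) ?_
  rintro _ ⟨f', g', rfl⟩ _ ⟨f, g, rfl⟩
  exact integral_jointGaussian_mul_inner_productVector ht ξ f' g' f g

theorem integral_jointGaussian_mul_wigner (hP : IsPositiveTraceClass P) {t : ℝ} (ht : 0 < t)
    (ξ : PhaseSpace m) :
    ∫ p, jointGaussian (t ^ 2) p * jointPlaneWave ξ p * wigner P p =
      ∫ q, (1 / π : ℝ) ^ (2 * m) * jointGaussian 1 q * charFun P (ξ + t • q) := by
  rw [← hP.integral_jointGaussian_mul_opTrace ht]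
  congr 1 with p
  rw [hP.ofReal_wigner]
  ring

theorem tendsto_integral_jointGaussian_mul_wigner (hP : IsPositiveTraceClass P)
    (ξ : PhaseSpace m) :
    Filter.Tendsto (fun t : ℝ => ∫ p, jointGaussian (t ^ 2) p * jointPlaneWave ξ p * wigner P p)
      (nhdsWithin 0 (Set.Ioi 0)) (nhds (charFun P ξ)) := by
  have hweight : Integrable fun q : PhaseSpace m =>
      ((1 / π : ℝ) ^ (2 * m) * jointGaussian 1 q : ℂ) :=
    (integrable_jointGaussian one_pos).ofReal.const_mul _
  have hone : ∫ q : PhaseSpace m, ((1 / π : ℝ) ^ (2 * m) * jointGaussian 1 q : ℂ) = 1 := by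
    rw [integral_const_mul, integral_complex_ofReal, integral_jointGaussian one_pos,
      ← Complex.ofReal_pow, ← Complex.ofReal_mul, ← mul_pow, div_one,
      one_div_mul_cancel Real.pi_ne_zero, one_pow, Complex.ofReal_one]
  have hlim : Filter.Tendsto
      (fun t : ℝ => ∫ q, (1 / π : ℝ) ^ (2 * m) * jointGaussian 1 q * charFun P (ξ + t • q))
      (nhds 0) (nhds (∫ q : PhaseSpace m,
        (1 / π : ℝ) ^ (2 * m) * jointGaussian 1 q * charFun P ξ)) := by
    refine tendsto_integral_filter_of_dominated_convergence
      (fun q => ‖((1 / π : ℝ) ^ (2 * m) * jointGaussian 1 q : ℂ)‖ * (positiveTrace P).toReal)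
      (.of_forall fun t => ?_) (.of_forall fun t => .of_forall fun q => ?_)
      (hweight.norm.mul_const _) (.of_forall fun q => ?_)
    · exact hweight.1.mul (hP.continuous_charFun.comp (by fun_prop)).aestronglyMeasurable
    · rw [norm_mul]
      gcongr
      exact (hP.norm_opTrace_mul_le _).trans
        (mul_le_of_le_one_right ENNReal.toReal_nonneg (norm_jointDisplacement_le _))
    · have h := (hP.continuous_charFun.comp
        (by fun_prop : Continuous fun t : ℝ => ξ + t • q)).tendsto 0
      rw [Function.comp_apply, zero_smul, add_zero] at h
      exact h.const_mul _
  rw [integral_mul_const, hone, one_mul] at hlim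
  refine (hlim.mono_left nhdsWithin_le_nhds).congr' ?_
  filter_upwards [self_mem_nhdsWithin] with t ht
  exact (hP.integral_jointGaussian_mul_wigner ht ξ).symm

end IsPositiveTraceClass

end Wigner

/-! ### The smallest eigenvalue -/

section Eigenvalue

variable {N : ℕ} {C : Matrix (Fin N) (Fin N) ℂ}

theorem realEigenvalues_eq (hC : C.IsHermitian) :
    realEigenvalues C = Set.range hC.eigenvalues := by
  ext μ
  rw [realEigenvalues, Set.mem_ofPred_eq, Module.End.hasEigenvalue_iff_mem_spectrum,
    Matrix.spectrum_toLin', hC.spectrum_eq_image_range]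
  exact Complex.ofReal_injective.mem_set_image

theorem isLeast_minEigenvalue (hN : 0 < N) (hC : C.IsHermitian) :
    IsLeast (realEigenvalues C) (minEigenvalue C) := by
  have hfinite : (realEigenvalues C).Finite := realEigenvalues_eq hC ▸ Set.finite_range _
  have hne : (realEigenvalues C).Nonempty := realEigenvalues_eq hC ▸ ⟨_, ⟨0, hN⟩, rfl⟩
  exact ⟨hne.csInf_mem hfinite, fun μ hμ => csInf_le hfinite.bddBelow hμ⟩

theorem exists_dotProduct_mulVec_eq (hC : C.IsHermitian) {μ : ℝ} (hμ : μ ∈ realEigenvalues C) :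
    ∃ v : Fin N → ℂ, ∑ j, ‖v j‖ ^ 2 = 1 ∧ (star v ⬝ᵥ C *ᵥ v).re = μ := by
  obtain ⟨i, rfl⟩ := realEigenvalues_eq hC ▸ hμ
  refine ⟨hC.eigenvectorBasis i, ?_, (hC.eigenvalues_eq i).symm⟩
  rw [← EuclideanSpace.norm_sq_eq, hC.eigenvectorBasis.norm_eq_one, one_pow]

end Eigenvalue

/-! ### The quadratic form of the witness -/

section Witness

theorem norm_sum_smul_sq_le_card {ι 𝕜 E : Type*} [Fintype ι] [NormedField 𝕜]
    [SeminormedAddCommGroup E] [NormedSpace 𝕜 E] {z : ι → 𝕜} (hz : ∑ i, ‖z i‖ ^ 2 = 1)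
    {T : ι → E} (hT : ∀ i, ‖T i‖ ≤ 1) : ‖∑ i, z i • T i‖ ^ 2 ≤ Fintype.card ι := by
  have hsum : ‖∑ i, z i • T i‖ ≤ ∑ i, ‖z i‖ :=
    norm_sum_le_of_le _ fun i _ =>
      (norm_smul_le _ _).trans (mul_le_of_le_one_right (norm_nonneg _) (hT i))
  calc ‖∑ i, z i • T i‖ ^ 2 ≤ (∑ i, ‖z i‖) ^ 2 := by gcongr
    _ ≤ Fintype.card ι * ∑ i, ‖z i‖ ^ 2 := sq_sum_le_card_mul_sum_sq
    _ = Fintype.card ι := by rw [hz, mul_one]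

variable {m N : ℕ} {P : Bipartite m →L[ℂ] Bipartite m} {ξA ξB : Fin N → Fin m → ℂ}

theorem C₂_apply (P : Bipartite m →L[ℂ] Bipartite m) (ξA ξB : Fin N → Fin m → ℂ) (j k : Fin N) :
    C₂ P ξA ξB j k = (1 / N : ℝ) * charFun P ((ξA j, ξB j) - (ξA k, ξB k)) := by
  rw [C₂, Matrix.of_apply, mul_assoc P, displacementA_mul_displacementB, charFun, Prod.mk_sub_mk,
    Complex.ofReal_div, Complex.ofReal_one, Complex.ofReal_natCast]

theorem IsPositiveTraceClass.charFun_neg (hP : IsPositiveTraceClass P) (ξ : PhaseSpace m) :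
    charFun P (-ξ) = starRingEnd ℂ (charFun P ξ) := by
  rw [charFun, charFun, ← adjoint_jointDisplacement, hP.opTrace_mul_adjoint]

theorem IsPositiveTraceClass.isHermitian_C₂ (hP : IsPositiveTraceClass P)
    (ξA ξB : Fin N → Fin m → ℂ) : (C₂ P ξA ξB).IsHermitian := by
  ext j k
  rw [Matrix.conjTranspose_apply, C₂_apply, C₂_apply, RCLike.star_def, map_mul, Complex.conj_ofReal,
    ← hP.charFun_neg, neg_sub]

theorem dotProduct_mulVec_C₂ (P : Bipartite m →L[ℂ] Bipartite m) (ξA ξB : Fin N → Fin m → ℂ)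
    (v : Fin N → ℂ) :
    star v ⬝ᵥ C₂ P ξA ξB *ᵥ v = (1 / N : ℝ) * ∑ j, ∑ k,
      star (v j) * v k * charFun P ((ξA j, ξB j) - (ξA k, ξB k)) := by
  simp only [dotProduct, Matrix.mulVec, C₂_apply, Finset.mul_sum, Pi.star_apply]
  refine Finset.sum_congr rfl fun j _ => Finset.sum_congr rfl fun k _ => ?_
  ring

theorem ofReal_witness_le (hN : 0 < N) (hP : IsPositiveTraceClass P) {B : ℝ≥0∞}
    (h : ∀ v : Fin N → ℂ, ∑ j, ‖v j‖ ^ 2 = 1 →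
      ENNReal.ofReal (-(star v ⬝ᵥ C₂ P ξA ξB *ᵥ v).re) ≤ B) :
    ENNReal.ofReal (witness P ξA ξB) ≤ B := by
  have hC := hP.isHermitian_C₂ ξA ξB
  obtain ⟨v, hv, hmin⟩ := exists_dotProduct_mulVec_eq hC (isLeast_minEigenvalue hN hC).1
  rw [witness, ENNReal.ofReal_max, ENNReal.ofReal_zero, ← hmin]
  exact max_le zero_le (h v hv)

theorem symplecticProduct_eq_of_doubled_eq {Λ : Matrix (Fin m ⊕ Fin m) (Fin m ⊕ Fin m) ℂ}
    (hΛ : Λᴴ * signMatrix m * Λ = signMatrix m)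
    (hΞ : ∀ k, doubled (ξA k) = Λ *ᵥ doubled (ξB k)) (i j : Fin N) :
    symplecticProduct m (ξA i) (ξA j) = symplecticProduct m (ξB i) (ξB j) := by
  have hform (ξ η : Fin m → ℂ) : star (doubled η) ⬝ᵥ (signMatrix m *ᵥ doubled ξ) =
      2 * Complex.I * symplecticProduct m ξ η := by
    simp only [doubled, signMatrix, Matrix.fromBlocks_mulVec, symplecticProduct_apply, dotProduct,
      Fintype.sum_sum_type, ← Finset.sum_add_distrib, Complex.ofReal_sum, Finset.mul_sum]
    refine Finset.sum_congr rfl fun k _ => ?_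
    apply Complex.ext <;> simp [Matrix.neg_mulVec]
    ring
  have h : star (doubled (ξA j)) ⬝ᵥ (signMatrix m *ᵥ doubled (ξA i)) =
      star (doubled (ξB j)) ⬝ᵥ (signMatrix m *ᵥ doubled (ξB i)) := by
    rw [hΞ, hΞ, Matrix.star_mulVec, ← Matrix.dotProduct_mulVec, Matrix.mulVec_mulVec,
      Matrix.mulVec_mulVec, hΛ]
  rw [hform, hform] at h
  exact_mod_cast mul_left_cancel₀ (by simp) h

end Witness

/-! ### The bound by the partial transpose -/

section PartialTranspose

variable {m N : ℕ} {P S S' : Bipartite m →L[ℂ] Bipartite m} {ξA ξB : Fin N → Fin m → ℂ}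
  {v : Fin N → ℂ}

/-- The vectors `eₐ ⊗ e_b*` of the orthonormal basis that partial transposition attaches to
`eₐ ⊗ e_b`. -/
def conjProductFamily (m : ℕ) (p : basisIndex (ModeSpace m) × basisIndex (ModeSpace m)) :
    Bipartite m :=
  productVector (basis (ModeSpace m) p.1) (star (basis (ModeSpace m) p.2))

theorem orthonormal_conjProductFamily : Orthonormal ℂ (conjProductFamily m) :=
  orthonormal_productVector (basis (ModeSpace m)).orthonormal
    (orthonormal_star (basis (ModeSpace m)).orthonormal)

/-- The partial transpose `D(ξ_A) ⊗ D(ξ_B)ᵀ = D(ξ_A) ⊗ D(-ξ_B*)` of a displacement operator. -/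
def transposedDisplacement (ξ : PhaseSpace m) : Bipartite m →L[ℂ] Bipartite m :=
  tensorOp (displacement ξ.1) (displacement (-star ξ.2))

theorem norm_transposedDisplacement_le (ξ : PhaseSpace m) : ‖transposedDisplacement ξ‖ ≤ 1 :=
  norm_jointDisplacement_le (ξ.1, -star ξ.2)

theorem IsPositiveTraceClass.hasSum_charFun_sub (hP : IsPositiveTraceClass P)
    (hS : IsPartialTranspose P S) {ξ η : PhaseSpace m}
    (h : symplecticProduct m ξ.1 η.1 = symplecticProduct m ξ.2 η.2) :
    HasSum (fun p => inner ℂ (transposedDisplacement η (conjProductFamily m p))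
      (S (transposedDisplacement ξ (conjProductFamily m p)))) (charFun P (ξ - η)) := by
  have hsum := hP.hasSum_inner_conj (tensorOp (displacement ξ.1) (displacement η.2).adjoint)
    (tensorOp (displacement η.1) (displacement ξ.2).adjoint)
    (productBasis (basis (ModeSpace m)) (basis (ModeSpace m)))
  rw [← ContinuousLinearMap.mul_def, ← jointDisplacement_sub_eq_mul_adjoint h] at hsum
  rw [charFun]
  convert hsum using 2 with p
  simp only [transposedDisplacement, conjProductFamily, productBasis_apply, tensorOp_productVector]
  rw [hS, star_displacement, star_displacement, adjoint_displacement, adjoint_displacement,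
    star_star, star_neg, star_neg, star_star, star_star]

theorem inner_sum_smul_apply {ι H : Type*} [Fintype ι] [NormedAddCommGroup H]
    [InnerProductSpace ℂ H] (S : H →L[ℂ] H) (z : ι → ℂ) (x : ι → H) :
    inner ℂ (∑ j, z j • x j) (S (∑ j, z j • x j)) =
      ∑ j, ∑ k, z j * star (z k) * inner ℂ (x k) (S (x j)) := by
  simp only [map_sum, map_smul, inner_sum, sum_inner, inner_smul_left, inner_smul_right,
    Finset.mul_sum, RCLike.star_def, mul_assoc]

/-- The operator `∑ⱼ vⱼ* (D(ξⱼᴬ) ⊗ D(ξⱼᴮ)ᵀ)`, conjugation of the partial transpose by which turns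
its trace into the quadratic form of `C₂`, up to the factor `1 / N`. -/
def transposedFactor (ξA ξB : Fin N → Fin m → ℂ) (v : Fin N → ℂ) :
    Bipartite m →L[ℂ] Bipartite m :=
  ∑ j, star (v j) • transposedDisplacement (ξA j, ξB j)

theorem transposedFactor_apply (ξA ξB : Fin N → Fin m → ℂ) (v : Fin N → ℂ) (x : Bipartite m) :
    transposedFactor ξA ξB v x = ∑ j, star (v j) • transposedDisplacement (ξA j, ξB j) x := by
  rw [transposedFactor, sum_apply]
  rfl

theorem enorm_transposedFactor_sq_le (ξA ξB : Fin N → Fin m → ℂ) (hv : ∑ j, ‖v j‖ ^ 2 = 1) :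
    ‖transposedFactor ξA ξB v‖ₑ ^ 2 ≤ N := by
  have hv' : ∑ j, ‖star (v j)‖ ^ 2 = 1 := by simpa only [norm_star] using hv
  have h := norm_sum_smul_sq_le_card (T := fun j => transposedDisplacement (ξA j, ξB j)) hv'
    fun j => norm_transposedDisplacement_le _
  rw [Fintype.card_fin] at h
  rw [← ofReal_norm, ← ENNReal.ofReal_pow (norm_nonneg _), ← ENNReal.ofReal_natCast]
  exact ENNReal.ofReal_le_ofReal h

theorem IsPositiveTraceClass.hasSum_dotProduct_mulVec_C₂ (hP : IsPositiveTraceClass P)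
    (hS : IsPartialTranspose P S)
    (h : ∀ i j, symplecticProduct m (ξA i) (ξA j) = symplecticProduct m (ξB i) (ξB j))
    (v : Fin N → ℂ) :
    HasSum (fun p => (1 / N : ℝ) * (inner ℂ (transposedFactor ξA ξB v (conjProductFamily m p))
      (S (transposedFactor ξA ξB v (conjProductFamily m p)))).re)
      (star v ⬝ᵥ C₂ P ξA ξB *ᵥ v).re := by
  have hsum := hasSum_sum fun j (_ : j ∈ Finset.univ) =>
    hasSum_sum fun k (_ : k ∈ Finset.univ) =>
      (hP.hasSum_charFun_sub hS (h j k) (ξ := (ξA j, ξB j)) (η := (ξA k, ξB k))).mul_left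
        (star (v j) * v k)
  rw [dotProduct_mulVec_C₂, Complex.re_ofReal_mul]
  simp only [transposedFactor_apply, inner_sum_smul_apply, star_star]
  exact (hsum.mapL Complex.reCLM).mul_left (1 / N : ℝ)

theorem IsPositiveTraceClass.re_dotProduct_mulVec_C₂_nonneg (hP : IsPositiveTraceClass P)
    (hS : IsPartialTranspose P S) (hSpos : S.IsPositive)
    (h : ∀ i j, symplecticProduct m (ξA i) (ξA j) = symplecticProduct m (ξB i) (ξB j))
    (v : Fin N → ℂ) : 0 ≤ (star v ⬝ᵥ C₂ P ξA ξB *ᵥ v).re :=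
  (hP.hasSum_dotProduct_mulVec_C₂ hS h v).nonneg fun _ =>
    mul_nonneg (by positivity) (hSpos.re_inner_nonneg_right _)

theorem ofReal_le_tsum_ofReal {ι : Type*} {f : ι → ℝ} {a : ℝ} (h : HasSum f a) :
    ENNReal.ofReal a ≤ ∑' i, ENNReal.ofReal (f i) :=
  le_of_tendsto ((ENNReal.continuous_ofReal.tendsto a).comp h) <| .of_forall fun s =>
    (Finset.le_sum_of_subadditive ENNReal.ofReal ENNReal.ofReal_zero.le
      (fun _ _ => ENNReal.ofReal_add_le) s f).trans (ENNReal.sum_le_tsum s)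

theorem tsum_ofReal_neg_re_inner_le {H : Type*} [NormedAddCommGroup H] [InnerProductSpace ℂ H]
    [CompleteSpace H] {S S' : H →L[ℂ] H} (hS : IsSelfAdjoint S) (hS' : S'.IsPositive)
    (F : H →L[ℂ] H) {ι : Type*} {u : ι → H} (hu : Orthonormal ℂ u) :
    ∑' i, ENNReal.ofReal (-(inner ℂ (F (u i)) (S (F (u i)))).re) ≤
      ‖F‖ₑ ^ 2 * traceNorm (S' - S) := by
  refine le_trans (ENNReal.tsum_le_tsum fun i => ENNReal.ofReal_le_ofReal ?_)
    (tsum_ofReal_re_inner_le (isPositive_abs (S' - S)) F hu)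
  have habs := re_inner_le_re_inner_abs (hS'.isSelfAdjoint.sub hS) (F (u i))
  have hpos : 0 ≤ (inner ℂ (F (u i)) (S' (F (u i)))).re := hS'.re_inner_nonneg_right _
  rw [sub_apply, inner_sub_right, Complex.sub_re] at habs
  linarith

theorem IsPositiveTraceClass.ofReal_neg_le_traceNorm_sub_partialTranspose (hN : 0 < N)
    (hP : IsPositiveTraceClass P) (hS : IsPartialTranspose P S) (hS' : S'.IsPositive)
    (h : ∀ i j, symplecticProduct m (ξA i) (ξA j) = symplecticProduct m (ξB i) (ξB j))
    (hv : ∑ j, ‖v j‖ ^ 2 = 1) :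
    ENNReal.ofReal (-(star v ⬝ᵥ C₂ P ξA ξB *ᵥ v).re) ≤ traceNorm (S' - S) := by
  have hSsa := hS.isSelfAdjoint hP.isPositive.isSelfAdjoint
  refine (ofReal_le_tsum_ofReal (hP.hasSum_dotProduct_mulVec_C₂ hS h v).neg).trans ?_
  simp only [← mul_neg, ENNReal.ofReal_mul (by positivity : (0 : ℝ) ≤ 1 / N)]
  rw [ENNReal.tsum_mul_left]
  calc _ ≤ ENNReal.ofReal (1 / N) * (N * traceNorm (S' - S)) :=
        mul_le_mul_right
          ((tsum_ofReal_neg_re_inner_le hSsa hS' _ orthonormal_conjProductFamily).trans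
            (mul_le_mul_left (enorm_transposedFactor_sq_le ξA ξB hv) _)) _
    _ = traceNorm (S' - S) := by
        rw [← mul_assoc, one_div, ENNReal.ofReal_inv_of_pos (by exact_mod_cast hN),
          ENNReal.ofReal_natCast, ENNReal.inv_mul_cancel (by exact_mod_cast hN.ne') (by simp),
          one_mul]

end PartialTranspose

/-! ### The bound by the distance to the separable states -/

section Separable

variable {m N : ℕ} {P Q : Bipartite m →L[ℂ] Bipartite m} {ξA ξB : Fin N → Fin m → ℂ}
  {v : Fin N → ℂ}

/-- The sum `∑ⱼₖ vⱼ* vₖ D(ξⱼ - ξₖ)`, `N` times the observable whose expectation is the quadratic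
form of `C₂`. -/
def displacementForm (ξA ξB : Fin N → Fin m → ℂ) (v : Fin N → ℂ) : Bipartite m →L[ℂ] Bipartite m :=
  ∑ p : Fin N × Fin N, (star (v p.1) * v p.2) •
    jointDisplacement ((ξA p.1, ξB p.1) - (ξA p.2, ξB p.2))

theorem IsPositiveTraceClass.dotProduct_mulVec_C₂_eq_opTrace (hP : IsPositiveTraceClass P)
    (ξA ξB : Fin N → Fin m → ℂ) (v : Fin N → ℂ) :
    star v ⬝ᵥ C₂ P ξA ξB *ᵥ v = (1 / N : ℝ) * opTrace (P * displacementForm ξA ξB v) := by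
  rw [dotProduct_mulVec_C₂, displacementForm, hP.opTrace_mul_sum, Fintype.sum_prod_type]
  simp only [charFun]
  congr! 3 with j - k
  rw [mul_smul_comm, opTrace_smul]

theorem norm_displacementForm_le (ξA ξB : Fin N → Fin m → ℂ) (hv : ∑ j, ‖v j‖ ^ 2 = 1) :
    ‖displacementForm ξA ξB v‖ ≤ N := by
  have hvv : ∑ p : Fin N × Fin N, ‖star (v p.1) * v p.2‖ ^ 2 = 1 := by
    simp only [norm_mul, norm_star, mul_pow]
    rw [Fintype.sum_prod_type' fun j k => ‖v j‖ ^ 2 * ‖v k‖ ^ 2, ← Finset.sum_mul_sum, hv, one_mul]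
  have h := norm_sum_smul_sq_le_card
    (T := fun p : Fin N × Fin N => jointDisplacement ((ξA p.1, ξB p.1) - (ξA p.2, ξB p.2))) hvv
    fun p => norm_jointDisplacement_le _
  rw [Fintype.card_prod, Fintype.card_fin, Nat.cast_mul, ← sq] at h
  exact le_of_sq_le_sq h (by positivity)

theorem IsPositiveTraceClass.abs_re_dotProduct_mulVec_C₂_sub_le (hN : 0 < N)
    (hP : IsPositiveTraceClass P) (hQ : IsPositiveTraceClass Q) (hPQ : traceNorm (P - Q) ≠ ⊤)
    (ξA ξB : Fin N → Fin m → ℂ) (hv : ∑ j, ‖v j‖ ^ 2 = 1) :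
    |(star v ⬝ᵥ C₂ P ξA ξB *ᵥ v).re - (star v ⬝ᵥ C₂ Q ξA ξB *ᵥ v).re| ≤
      (traceNorm (P - Q)).toReal := by
  have hN' : (0 : ℝ) < N := by exact_mod_cast hN
  have hform : ‖opTrace (P * displacementForm ξA ξB v) -
      opTrace (Q * displacementForm ξA ξB v)‖ ≤ (traceNorm (P - Q)).toReal * N :=
    (norm_opTrace_mul_sub_le hP hQ hPQ _).trans <|
      mul_le_mul_of_nonneg_left (norm_displacementForm_le ξA ξB hv) ENNReal.toReal_nonneg
  rw [hP.dotProduct_mulVec_C₂_eq_opTrace, hQ.dotProduct_mulVec_C₂_eq_opTrace, ← Complex.sub_re,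
    ← mul_sub]
  refine (Complex.abs_re_le_norm _).trans ?_
  rwa [norm_mul, Complex.norm_real, Real.norm_of_nonneg (by positivity), one_div,
    inv_mul_le_iff₀ hN', mul_comm]

theorem re_dotProduct_mulVec_C₂_nonneg_of_mem_SEP (hN : 0 < N) (hQ : Q ∈ SEP m)
    (h : ∀ i j, symplecticProduct m (ξA i) (ξA j) = symplecticProduct m (ξB i) (ξB j))
    (hv : ∑ j, ‖v j‖ ^ 2 = 1) : 0 ≤ (star v ⬝ᵥ C₂ Q ξA ξB *ᵥ v).re := by
  have hsub : convexHull ℝ (productStates m) ⊆ positivePT m :=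
    convexHull_min productStates_subset_positivePT convex_positivePT
  obtain ⟨hQstate, hlim⟩ := hQ
  refine le_of_forall_pos_le_add fun ε hε => ?_
  obtain ⟨τ, hτ, hτε⟩ := hlim (ENNReal.ofReal ε) (ENNReal.ofReal_pos.2 hε)
  obtain ⟨hτtc, S, hS, hτS⟩ := hsub hτ
  have hdist := hQstate.isPositiveTraceClass.abs_re_dotProduct_mulVec_C₂_sub_le hN hτtc
    hτε.ne_top ξA ξB hv
  have hε' : (traceNorm (Q - τ)).toReal ≤ ε := ENNReal.toReal_le_of_le_ofReal hε.le hτε.le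
  linarith [(abs_le.1 (hdist.trans hε')).1, hτtc.re_dotProduct_mulVec_C₂_nonneg hτS hS h v]

theorem IsPositiveTraceClass.ofReal_neg_le_traceNorm_sub_of_mem_SEP (hN : 0 < N)
    (hP : IsPositiveTraceClass P) (hQ : Q ∈ SEP m)
    (h : ∀ i j, symplecticProduct m (ξA i) (ξA j) = symplecticProduct m (ξB i) (ξB j))
    (hv : ∑ j, ‖v j‖ ^ 2 = 1) :
    ENNReal.ofReal (-(star v ⬝ᵥ C₂ P ξA ξB *ᵥ v).re) ≤ traceNorm (Q - P) := by
  by_cases htop : traceNorm (Q - P) = ⊤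
  · exact htop ▸ le_top
  refine ENNReal.ofReal_le_of_le_toReal ?_
  have hdist := hQ.1.isPositiveTraceClass.abs_re_dotProduct_mulVec_C₂_sub_le hN hP htop ξA ξB hv
  linarith [(abs_le.1 hdist).2, re_dotProduct_mulVec_C₂_nonneg_of_mem_SEP hN hQ h hv]

end Separable

/-! ### The bound by the Wigner negativity volume -/

section Negativity

theorem ofReal_integral_le_lintegral_ofReal {X : Type*} [MeasurableSpace X] {μ : Measure X}
    {f : X → ℝ} (hf : Integrable f μ) :
    ENNReal.ofReal (∫ x, f x ∂μ) ≤ ∫⁻ x, ENNReal.ofReal (f x) ∂μ := by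
  rw [integral_eq_lintegral_pos_part_sub_lintegral_neg_part hf]
  exact (ENNReal.ofReal_le_ofReal (sub_le_self _ ENNReal.toReal_nonneg)).trans
    ENNReal.ofReal_toReal_le

variable {m N : ℕ} {P : Bipartite m →L[ℂ] Bipartite m}

theorem jointPlaneWave_sub (ξ η p : PhaseSpace m) :
    jointPlaneWave (ξ - η) p = jointPlaneWave ξ p * starRingEnd ℂ (jointPlaneWave η p) := by
  simp only [jointPlaneWave, planeWave, Prod.fst_sub, Prod.snd_sub, map_sub, LinearMap.sub_apply,
    ← Complex.exp_conj, ← Complex.exp_add]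
  congr 1
  simp only [map_add, map_mul, Complex.conj_ofReal, Complex.conj_I]
  push_cast
  ring

theorem IsPositiveTraceClass.integrable_jointGaussian_mul_wigner (hP : IsPositiveTraceClass P)
    {s : ℝ} (hs : 0 < s) (ξ : PhaseSpace m) :
    Integrable fun p => jointGaussian s p * jointPlaneWave ξ p * wigner P p := by
  simp_rw [hP.ofReal_wigner, mul_left_comm _ (((2 / Real.pi : ℝ) : ℂ) ^ (2 * m))]
  refine ((integrable_jointGaussian_mul_jointPlaneWave hs ξ).mul_bdd
    (c := (positiveTrace P).toReal) ?_ (.of_forall fun p => ?_)).const_mul _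
  · exact (hP.continuous_opTrace_mul norm_jointDisplacedParity_le
      continuous_jointDisplacedParity).aestronglyMeasurable
  · exact (hP.norm_opTrace_mul_le _).trans
      (mul_le_of_le_one_right ENNReal.toReal_nonneg (norm_jointDisplacedParity_le p))

/-- The filter `exp(-s |p|²) |∑ⱼ vⱼ* wⱼ(p)|² / N`, where `wⱼ` is the plane wave of wave vector `ξⱼ`:
integrated against the Wigner function, it gives the quadratic form of `C₂` as `s → 0`. -/
def phaseSpaceFilter (s : ℝ) (ξA ξB : Fin N → Fin m → ℂ) (v : Fin N → ℂ) (p : PhaseSpace m) : ℝ :=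
  jointGaussian s p * (‖∑ j, star (v j) • jointPlaneWave (ξA j, ξB j) p‖ ^ 2 / N)

theorem phaseSpaceFilter_nonneg (s : ℝ) (ξA ξB : Fin N → Fin m → ℂ) (v : Fin N → ℂ)
    (p : PhaseSpace m) : 0 ≤ phaseSpaceFilter s ξA ξB v p :=
  mul_nonneg (jointGaussian_nonneg s p) (by positivity)

theorem phaseSpaceFilter_le_one {s : ℝ} (hs : 0 ≤ s) (ξA ξB : Fin N → Fin m → ℂ) {v : Fin N → ℂ}
    (hv : ∑ j, ‖v j‖ ^ 2 = 1) (p : PhaseSpace m) : phaseSpaceFilter s ξA ξB v p ≤ 1 := by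
  have hv' : ∑ j, ‖star (v j)‖ ^ 2 = 1 := by simpa only [norm_star] using hv
  have h := norm_sum_smul_sq_le_card (T := fun j => jointPlaneWave (ξA j, ξB j) p) hv'
    fun j => (norm_jointPlaneWave _ p).le
  rw [Fintype.card_fin] at h
  exact mul_le_one₀ (jointGaussian_le_one hs p) (by positivity)
    (div_le_one_of_le₀ h (Nat.cast_nonneg N))

theorem ofReal_phaseSpaceFilter (s : ℝ) (ξA ξB : Fin N → Fin m → ℂ) (v : Fin N → ℂ)
    (p : PhaseSpace m) : (phaseSpaceFilter s ξA ξB v p : ℂ) =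
      (1 / N : ℝ) * ∑ j, ∑ k, star (v j) * v k *
        (jointGaussian s p * jointPlaneWave ((ξA j, ξB j) - (ξA k, ξB k)) p) := by
  rw [phaseSpaceFilter, Complex.ofReal_mul, Complex.ofReal_div, Complex.ofReal_pow,
    ← Complex.mul_conj', map_sum, Finset.sum_mul_sum]
  simp only [jointPlaneWave_sub, smul_eq_mul, map_mul, Complex.star_def, Complex.conj_conj,
    Finset.mul_sum, Finset.sum_div]
  congr! 2 with j - k
  push_cast
  ring

theorem IsPositiveTraceClass.integrable_phaseSpaceFilter_mul_wigner (hP : IsPositiveTraceClass P)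
    {s : ℝ} (hs : 0 < s) (ξA ξB : Fin N → Fin m → ℂ) (v : Fin N → ℂ) :
    Integrable fun p => phaseSpaceFilter s ξA ξB v p * wigner P p := by
  have h : Integrable fun p => ((phaseSpaceFilter s ξA ξB v p * wigner P p : ℝ) : ℂ) := by
    simp_rw [Complex.ofReal_mul, ofReal_phaseSpaceFilter, mul_assoc, Finset.sum_mul, mul_assoc]
    refine (integrable_finsetSum _ fun j _ => integrable_finsetSum _ fun k _ => ?_).const_mul _
    simpa only [mul_assoc] using
      ((hP.integrable_jointGaussian_mul_wigner hs ((ξA j, ξB j) - (ξA k, ξB k))).const_mul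
        (v k)).const_mul (star (v j))
  exact h.re

theorem IsPositiveTraceClass.integral_phaseSpaceFilter_mul_wigner (hP : IsPositiveTraceClass P)
    {s : ℝ} (hs : 0 < s) (ξA ξB : Fin N → Fin m → ℂ) (v : Fin N → ℂ) :
    ((∫ p, phaseSpaceFilter s ξA ξB v p * wigner P p : ℝ) : ℂ) =
      (1 / N : ℝ) * ∑ j, ∑ k, star (v j) * v k *
        ∫ p, jointGaussian s p * jointPlaneWave ((ξA j, ξB j) - (ξA k, ξB k)) p * wigner P p := by
  have hint (j k : Fin N) := (hP.integrable_jointGaussian_mul_wigner hs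
    ((ξA j, ξB j) - (ξA k, ξB k))).const_mul (star (v j) * v k)
  simp_rw [← integral_complex_ofReal, ← integral_const_mul]
  simp_rw [← integral_finsetSum Finset.univ fun k _ => hint _ k]
  rw [← integral_finsetSum _ fun j _ => integrable_finsetSum _ fun k _ => hint j k,
    ← integral_const_mul]
  simp_rw [Complex.ofReal_mul, ofReal_phaseSpaceFilter, mul_assoc, Finset.sum_mul, mul_assoc]

theorem IsPositiveTraceClass.tendsto_integral_phaseSpaceFilter_mul_wigner
    (hP : IsPositiveTraceClass P) (ξA ξB : Fin N → Fin m → ℂ) (v : Fin N → ℂ) :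
    Filter.Tendsto (fun t : ℝ => ∫ p, phaseSpaceFilter (t ^ 2) ξA ξB v p * wigner P p)
      (nhdsWithin 0 (Set.Ioi 0)) (nhds (star v ⬝ᵥ C₂ P ξA ξB *ᵥ v).re) := by
  have h := (tendsto_finsetSum Finset.univ fun j _ => tendsto_finsetSum Finset.univ fun k _ =>
    (hP.tendsto_integral_jointGaussian_mul_wigner ((ξA j, ξB j) - (ξA k, ξB k))).const_mul
      (star (v j) * v k)).const_mul ((1 / N : ℝ) : ℂ)
  rw [← dotProduct_mulVec_C₂] at h
  refine ((Complex.continuous_re.tendsto _).comp h).congr' ?_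
  filter_upwards [self_mem_nhdsWithin] with t (ht : 0 < t)
  rw [Function.comp_apply, ← hP.integral_phaseSpaceFilter_mul_wigner (by positivity),
    Complex.ofReal_re]

theorem ofReal_neg_integral_mul_wigner_le_negativityVolume {F : PhaseSpace m → ℝ}
    (hF : ∀ p, F p ∈ Set.Icc 0 1) (hint : Integrable fun p => F p * wigner P p) :
    ENNReal.ofReal (-∫ p, F p * wigner P p) ≤ negativityVolume P := by
  rw [← integral_neg]
  refine (ofReal_integral_le_lintegral_ofReal hint.neg).trans
    (lintegral_mono fun p => ENNReal.ofReal_le_ofReal ?_)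
  have hneg : 0 ≤ (|wigner P p| - wigner P p) / 2 := by linarith [le_abs_self (wigner P p)]
  calc -(F p * wigner P p) = F p * -wigner P p := by ring
    _ ≤ F p * ((|wigner P p| - wigner P p) / 2) :=
        mul_le_mul_of_nonneg_left (by linarith [neg_le_abs (wigner P p)]) (hF p).1
    _ ≤ (|wigner P p| - wigner P p) / 2 := mul_le_of_le_one_left hneg (hF p).2

theorem IsPositiveTraceClass.ofReal_neg_le_negativityVolume (hP : IsPositiveTraceClass P)
    (ξA ξB : Fin N → Fin m → ℂ) {v : Fin N → ℂ} (hv : ∑ j, ‖v j‖ ^ 2 = 1) :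
    ENNReal.ofReal (-(star v ⬝ᵥ C₂ P ξA ξB *ᵥ v).re) ≤ negativityVolume P := by
  refine le_of_tendsto ((ENNReal.continuous_ofReal.tendsto _).comp
    (hP.tendsto_integral_phaseSpaceFilter_mul_wigner ξA ξB v).neg) ?_
  filter_upwards [self_mem_nhdsWithin] with t (ht : 0 < t)
  exact ofReal_neg_integral_mul_wigner_le_negativityVolume
    (fun p => ⟨phaseSpaceFilter_nonneg _ ξA ξB v p,
      phaseSpaceFilter_le_one (sq_nonneg t) ξA ξB hv p⟩)
    (hP.integrable_phaseSpaceFilter_mul_wigner (by positivity) ξA ξB v)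

end Negativity

/-! ### Vanishing of the entanglement measures -/

section Faithful

variable {m : ℕ} {P : Bipartite m →L[ℂ] Bipartite m}

theorem entanglementSEP_eq_zero (hP : P ∈ SEP m) : entanglementSEP P = 0 :=
  le_zero_iff.1 <| (iInf₂_le P hP).trans (by rw [sub_self, traceNorm_zero])

theorem entanglementPPT_eq_zero (hP : P ∈ PPT m) : entanglementPPT P = 0 :=
  le_zero_iff.1 <| (iInf₂_le P hP).trans (by rw [sub_self, traceNorm_zero])

theorem negativityVolume_eq_zero (hP : ∀ α, 0 ≤ wigner P α) : negativityVolume P = 0 := by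
  simp only [negativityVolume, abs_of_nonneg (hP _), sub_self, zero_div, ENNReal.ofReal_zero,
    lintegral_zero]

end Faithful

end ECDWitness

end

theorem corollary1_general (m N : ℕ) (hN : 0 < N) (ξA ξB : Fin N → Fin m → ℂ)
    (hΞ : ∀ i j, ECDWitness.symplecticProduct m (ξA i) (ξA j) =
      ECDWitness.symplecticProduct m (ξB i) (ξB j))
    (ρ : ECDWitness.Bipartite m →L[ℂ] ECDWitness.Bipartite m)
    (hρ : ECDWitness.IsPositiveTraceClass ρ) :
    (∀ σ : ECDWitness.Bipartite m →L[ℂ] ECDWitness.Bipartite m,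
      ECDWitness.IsPositiveTraceClass σ →
        ECDWitness.IsPartialTranspose σ (ECDWitness.partialTranspose σ)) ∧
    (ECDWitness.C₂ ρ ξA ξB).IsHermitian ∧
    IsLeast (ECDWitness.realEigenvalues (ECDWitness.C₂ ρ ξA ξB))
      (ECDWitness.minEigenvalue (ECDWitness.C₂ ρ ξA ξB)) ∧
    ENNReal.ofReal (ECDWitness.witness ρ ξA ξB) ≤ ECDWitness.entanglementSEP ρ ∧
    ENNReal.ofReal (ECDWitness.witness ρ ξA ξB) ≤ ECDWitness.entanglementPPT ρ ∧
    ENNReal.ofReal (ECDWitness.witness ρ ξA ξB) ≤ ECDWitness.negativityVolume ρ ∧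
    (0 < ECDWitness.witness ρ ξA ξB →
      ρ ∉ ECDWitness.SEP m ∧ ρ ∉ ECDWitness.PPT m ∧ ∃ α, ECDWitness.wigner ρ α < 0) := by
  open ECDWitness in
  have hSEP : ENNReal.ofReal (witness ρ ξA ξB) ≤ entanglementSEP ρ :=
    le_iInf₂ fun σ hσ => ofReal_witness_le hN hρ fun v hv =>
      hρ.ofReal_neg_le_traceNorm_sub_of_mem_SEP hN hσ hΞ hv
  have hPPT : ENNReal.ofReal (witness ρ ξA ξB) ≤ entanglementPPT ρ :=
    le_iInf₂ fun σ hσ => ofReal_witness_le hN hρ fun v hv =>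
      hρ.ofReal_neg_le_traceNorm_sub_partialTranspose hN hρ.isPartialTranspose hσ.2 hΞ hv
  have hWigner : ENNReal.ofReal (witness ρ ξA ξB) ≤ negativityVolume ρ :=
    ofReal_witness_le hN hρ fun v hv => hρ.ofReal_neg_le_negativityVolume ξA ξB hv
  have hC := hρ.isHermitian_C₂ ξA ξB
  refine ⟨fun σ hσ => hσ.isPartialTranspose, hC, isLeast_minEigenvalue hN hC, hSEP, hPPT, hWigner,
    fun hpos => ?_⟩
  rw [← ENNReal.ofReal_pos] at hpos
  refine ⟨fun h => (hpos.trans_le hSEP).ne' (entanglementSEP_eq_zero h),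
    fun h => (hpos.trans_le hPPT).ne' (entanglementPPT_eq_zero h), ?_⟩
  by_contra! h
  exact (hpos.trans_le hWigner).ne' (negativityVolume_eq_zero h)

theorem corollary1 (m N : ℕ) (hN : 0 < N) (ξA ξB : Fin N → Fin m → ℂ)
    (Λ : Matrix (Fin m ⊕ Fin m) (Fin m ⊕ Fin m) ℂ)
    (hΛ : Λᴴ * ECDWitness.signMatrix m * Λ = ECDWitness.signMatrix m)
    (hΞ : ∀ k, ECDWitness.doubled (ξA k) = Λ *ᵥ ECDWitness.doubled (ξB k))
    (ρ : ECDWitness.Bipartite m →L[ℂ] ECDWitness.Bipartite m) (hρ : ECDWitness.IsState ρ) :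
    -- the partial transpose and the smallest eigenvalue are well defined
    (∀ σ : ECDWitness.Bipartite m →L[ℂ] ECDWitness.Bipartite m, ECDWitness.IsState σ →
      ECDWitness.IsPartialTranspose σ (ECDWitness.partialTranspose σ)) ∧
    (ECDWitness.C₂ ρ ξA ξB).IsHermitian ∧
    IsLeast (ECDWitness.realEigenvalues (ECDWitness.C₂ ρ ξA ξB))
      (ECDWitness.minEigenvalue (ECDWitness.C₂ ρ ξA ξB)) ∧
    -- the lower bounds
    ENNReal.ofReal (ECDWitness.witness ρ ξA ξB) ≤ ECDWitness.entanglementSEP ρ ∧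
    ENNReal.ofReal (ECDWitness.witness ρ ξA ξB) ≤ ECDWitness.entanglementPPT ρ ∧
    ENNReal.ofReal (ECDWitness.witness ρ ξA ξB) ≤ ECDWitness.negativityVolume ρ ∧
    -- the certificates
    (0 < ECDWitness.witness ρ ξA ξB →
      ρ ∉ ECDWitness.SEP m ∧ ρ ∉ ECDWitness.PPT m ∧ ∃ α, ECDWitness.wigner ρ α < 0) :=
  have ⟨hT, h⟩ := corollary1_general m N hN ξA ξB
    (ECDWitness.symplecticProduct_eq_of_doubled_eq hΛ hΞ) ρ hρ.isPositiveTraceClass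
  ⟨fun σ hσ => hT σ hσ.isPositiveTraceClass, h⟩
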